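/- Let $H$ be a (real or complex) Hilbert space, let $A$ be a (possibly unbounded) self-adjoint positive-definite linear operator in $H$ with domain $D(A)$, let $0<\alpha<1$, $\beta(t)=t^{\alpha-1}/\Gamma(\alpha)$ and $c>0$. Let $u$ be a solution, continuous on $[0,\infty)$ with values in $D(A)$, of $$u_t(t)+Au(t)+\int_0^t\beta(t-\zeta)\,Au(\zeta)\,d\zeta=f(t)\quad(t>0),\qquad u(0)=u_0 ,$$ such that $u_t$ exists on $[0,\infty)$ (one-sided at $0$) with values in $D(A)$, $u_{tt}$ exists on $(0,\infty)$ with values in $D(A)$, and $u_{ttt}$ exists on $(0,\infty)$ (derivatives in the norm of $H$). Let $k>0$, $t_n=nk$, and let $U^n\in D(A)$, $n\ge 0$, satisfy the BDF2 scheme $$U^0=u_0,\qquad \delta_tU^1+AU^1+Q_1(AU)=f(t_1),\qquad \tfrac32\delta_tU^n-\tfrac12\delta_tU^{n-1}+AU^n+Q_n(AU)=f(t_n)\quad(n\ge2),$$ where $\delta_tv^n=(v^n-v^{n-1})/k$ and $Q_n$ is the second-order BDF2-based convolution quadrature with starting correction $$Q_n(\varphi)=\varpi_{n,0}\,\varphi^0+k^\alpha\sum_{p=1}^n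 w_{n-p}\,\varphi^p,\qquad \Big[\tfrac{(3-z)(1-z)}2\Big]^{-\alpha}=\sum_{m\ge0}w_mz^m,\qquad \varpi_{n,0}=\int_0^{t_n}\beta(t_n-\zeta)\,d\zeta-k^\alpha\sum_{p=1}^n w_{n-p}\quad(n\ge1).$$ Put $\|v^n\|_A=\big(\sum_{n=0}^\infty e^{-cn}\|v^n\|^2\big)^{1/2}$ for a sequence $(v^n)_{n\ge 0}$ in $H$. Then there is a constant $\mathcal C>0$ depending only on $\alpha$ and $c$ such that $$\begin{aligned}\|U^n-u(t_n)\|_A\le \mathcal C k\Big\{&\sum_{n=1}^\infty e^{-\frac c2n}\int_0^{2k}\|u_{tt}(\zeta)\|\,d\zeta+k\sum_{n=2}^\infty e^{-\frac c2n}\int_{t_{n-1}}^{t_n}\|u_{ttt}(\zeta)\|\,d\zeta\\&+\sum_{n=1}^\infty e^{-\frac c2n}\Big(k^2t_n^{\alpha-1}\|Au_t(0)\|+k^{\alpha+1}\int_{t_{n-1}}^{t_n}\|Au_{tt}(\zeta)\|\,d\zeta+k^2\int_0^{t_{n-1}}(t_n-\zeta)^{\alpha-1}\|Au_{tt}(\zeta)\|\,d\zeta\Big)\Big\}.\end{aligned}$$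 Both sides are understood in $[0,\infty]$; in particular, the left side is finite whenever the right side is. -/

import Mathlib

open MeasureTheory Set
open scoped ENNReal

noncomputable section

namespace BDF2Abel

/-- The Abel kernel `β(t) = t^(α-1) / Γ(α)`. -/
def abelKernel (α t : ℝ) : ℝ := t ^ (α - 1) / Real.Gamma α

/-- The convolution `(β * φ)(t) = ∫₀ᵗ β(t - ζ) φ(ζ) dζ`. -/
def conv {E : Type*} [NormedAddCommGroup E] [NormedSpace ℝ E]
    (β : ℝ → ℝ) (φ : ℝ → E) (t : ℝ) : E :=
  ∫ ζ in (0 : ℝ)..t, β (t - ζ) • φ ζ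

/-- The convolution quadrature weights: `cqWeight α m` is the `m`-th Taylor coefficient at `z = 0`
of `((3 - z) (1 - z) / 2) ^ (-α)`. -/
def cqWeight (α : ℝ) (m : ℕ) : ℝ :=
  iteratedDeriv m (fun z : ℝ => ((3 - z) * (1 - z) / 2) ^ (-α)) 0 / (m.factorial : ℝ)

/-- The starting weight at level `n`; it makes the quadrature rule `cqRule` exact on constants. -/
def startWeight (α k : ℝ) (n : ℕ) : ℝ :=
  conv (abelKernel α) (fun _ => (1 : ℝ)) (n * k)
    - k ^ α * ∑ p ∈ Finset.Icc 1 n, cqWeight α (n - p)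

/-- The quadrature rule `Q_n(φ)`, approximating `(β * φ)(n k)` from the values `φ p` at `p k`. -/
def cqRule {E : Type*} [NormedAddCommGroup E] [NormedSpace ℝ E]
    (α k : ℝ) (φ : ℕ → E) (n : ℕ) : E :=
  startWeight α k n • φ 0 + k ^ α • ∑ p ∈ Finset.Icc 1 n, cqWeight α (n - p) • φ p

/-- The backward difference quotient `δ_t v^n = (v^n - v^(n-1)) / k`, used for `n ≥ 1`. -/
def bdiff {E : Type*} [NormedAddCommGroup E] [NormedSpace ℝ E]
    (k : ℝ) (v : ℕ → E) (n : ℕ) : E :=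
  k⁻¹ • (v n - v (n - 1))

/-- The BDF2 difference quotient `(3/2) δ_t v^n - (1/2) δ_t v^(n-1)`, used for `n ≥ 2`. -/
def bdiff2 {E : Type*} [NormedAddCommGroup E] [NormedSpace ℝ E]
    (k : ℝ) (v : ℕ → E) (n : ℕ) : E :=
  (3 / 2 : ℝ) • bdiff k v n - (1 / 2 : ℝ) • bdiff k v (n - 1)

/-- The weighted norm `(∑_{n ≥ 0} e^(-c n) ‖v^n‖²)^(1/2)`, with value in `[0, ∞]`. -/
def weightedNorm {E : Type*} [NormedAddCommGroup E] (c : ℝ) (v : ℕ → E) : ℝ≥0∞ :=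
  (∑' n : ℕ, ENNReal.ofReal (Real.exp (-c * n)) * ‖v n‖ₑ ^ 2) ^ (1 / 2 : ℝ)

variable {𝕜 H : Type*} [RCLike 𝕜] [NormedAddCommGroup H] [InnerProductSpace 𝕜 H]

/-- A (possibly unbounded) self-adjoint positive definite operator; self-adjointness includes
that the domain is dense. -/
structure IsSelfAdjointPosDef [CompleteSpace H] (A : H →ₗ.[𝕜] H) : Prop where
  selfAdjoint : IsSelfAdjoint A
  pos : ∀ x : A.domain, x ≠ 0 → 0 < RCLike.re (inner 𝕜 (A x) (x : H))

/-- `u` solves `u' + A u + β * A u = f` for `t > 0`, with `u(0) = u₀`. Only the values of `u` at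
`t ≥ 0` matter. -/
structure IsSolution [NormedSpace ℝ H] (A : H →ₗ.[𝕜] H) (β : ℝ → ℝ) (f : ℝ → H) (u₀ : H)
    (u : ℝ → A.domain) : Prop where
  initial : (u 0 : H) = u₀
  continuousOn : ContinuousOn (fun t => (u t : H)) (Ici 0)
  integrable : ∀ t > 0, IntervalIntegrable (fun ζ => β (t - ζ) • A (u ζ)) volume 0 t
  differentiable : ∀ t > 0, DifferentiableAt ℝ (fun s => (u s : H)) t
  equation : ∀ t > 0,
    deriv (fun s => (u s : H)) t + A (u t) + conv β (fun ζ => A (u ζ)) t = f t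

/-- `u₁ = u_t` on `[0, ∞)` (one-sided derivative at `0`), and `u₂ = u_tt`, `u₃ = u_ttt` on
`(0, ∞)`, all derivatives being taken in the norm of `H`. That `u₁` and `u₂` take their values in
the domain of `A` is what gives a meaning to `A u_t(0)` and `A u_tt`. -/
structure HasTimeDerivs [NormedSpace ℝ H] (A : H →ₗ.[𝕜] H) (u u₁ u₂ : ℝ → A.domain)
    (u₃ : ℝ → H) : Prop where
  first : ∀ t ≥ 0, HasDerivWithinAt (fun s => (u s : H)) (u₁ t : H) (Ici 0) t
  second : ∀ t > 0, HasDerivAt (fun s => (u₁ s : H)) (u₂ t : H) t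
  third : ∀ t > 0, HasDerivAt (fun s => (u₂ s : H)) (u₃ t) t

/-- `U` solves the BDF2 scheme with step `k`, whose first step is a backward Euler step, and with
the convolution quadrature `cqRule` for the Abel kernel. -/
structure IsBDF2Solution [NormedSpace ℝ H] (A : H →ₗ.[𝕜] H) (α k : ℝ) (f : ℝ → H) (u₀ : H)
    (U : ℕ → A.domain) : Prop where
  initial : (U 0 : H) = u₀
  first : bdiff k (fun n => (U n : H)) 1 + A (U 1) + cqRule α k (fun n => A (U n)) 1 = f k
  step : ∀ n ≥ 2,
    bdiff2 k (fun n => (U n : H)) n + A (U n) + cqRule α k (fun n => A (U n)) n = f (n * k)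

end BDF2Abel

end

/-! The error e^n = U^n - u(t_n) vanishes at n = 0 and solves the scheme with the truncation error
as source, so the estimate is stability plus consistency.

Stability. Test with e^n and weight by r^(2n), r = e^(-c/2). The BDF2 difference telescopes up to a
square (`bdf2_gStability`), ⟨A e, e⟩ is nonnegative, and so is the weighted sum of the memory terms
(`cq_form_nonneg`). The last fact holds because (3 - z)(1 - z)/2 maps the unit disc into the right
half-plane (A-stability of BDF2), hence so does its power -α; integrating over the circle of radius
r gives a nonnegative Toeplitz form, and the Schur product theorem transfers this to the Gram form
⟨e^n, A e^p⟩. Summation by parts against the decaying weights gains a factor 1 - r^2, which yields a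
bound on the whole half-line (`scheme_stability`).

Consistency. The difference quotients are handled by Taylor expansion. The quadrature is exact on
constants, so its error has a Peano kernel, which is its error on truncated linear functions. The
weights are the coefficients of (1 - z)^(-α) convolved with the geometrically decaying coefficients
of ((3 - z)/2)^(-α). To the order needed, only the value 1 and the derivative α/2 of the latter at z
= 1 matter, and α/2 exactly matches the second term in the asymptotics of the binomial coefficients.
This gives a kernel of size k^2 (t_n - s)^(α-1), and k^(α+1) on the last step
(`exists_abs_sum_cqWeight_sub_le`, `exists_abs_peanoKernel_le`).

Duality. A u is not assumed differentiable. For y in the domain, ⟨y, A u⟩ = ⟨A y, u⟩ is a real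
function as smooth as u; it is estimated as such, A is moved back onto the derivatives of u, and
density of the domain gives the norm (`enorm_le_of_rePairing_le`). All the calculus is therefore
real-valued. -/

noncomputable section

namespace BDF2Abel

open Filter Topology

/-! ### Taylor coefficients of the symbol. -/

/-- The `m`-th Taylor coefficient at `0` of `(1 - z) ^ (-a)`. -/
def binomCoeff (a : ℝ) (m : ℕ) : ℝ := ∏ i ∈ Finset.range m, (a + i) / (i + 1)

@[simp] lemma binomCoeff_zero (a : ℝ) : binomCoeff a 0 = 1 := by simp [binomCoeff]

lemma binomCoeff_succ (a : ℝ) (m : ℕ) :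
    binomCoeff a (m + 1) = binomCoeff a m * ((a + m) / (m + 1)) := by
  rw [binomCoeff, Finset.prod_range_succ, ← binomCoeff]

lemma binomCoeff_pos {a : ℝ} (ha : 0 < a) (m : ℕ) : 0 < binomCoeff a m :=
  Finset.prod_pos fun i _ => by positivity

lemma choose_eq_binomCoeff (a : ℝ) (m : ℕ) : Ring.choose (a + m - 1) m = binomCoeff a m := by
  have h1 : (m.factorial : ℝ) * Ring.choose (a + m - 1) m = (ascPochhammer ℝ m).eval a := by
    have h := Ring.factorial_nsmul_multichoose_eq_ascPochhammer a m
    rw [nsmul_eq_mul] at h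
    rw [Ring.choose]
    rw [show a + m - 1 - (m : ℝ) + 1 = a by ring, h,
      Polynomial.ascPochhammer_smeval_eq_eval]
  have h2 : (m.factorial : ℝ) * binomCoeff a m = (ascPochhammer ℝ m).eval a := by
    clear h1
    induction m with
    | zero => simp
    | succ m ih =>
      rw [ascPochhammer_succ_eval, ← ih, binomCoeff_succ, Nat.factorial_succ]
      push_cast
      field_simp
  have h3 : (m.factorial : ℝ) ≠ 0 := by positivity
  exact mul_left_cancel₀ h3 (h1.trans h2.symm)

lemma hasSum_binomCoeff (a : ℝ) {z : ℂ} (hz : ‖z‖ < 1) :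
    HasSum (fun m => (binomCoeff a m : ℂ) * z ^ m) ((1 - z) ^ (-(a : ℂ))) := by
  have h := (Complex.one_div_one_sub_cpow_hasFPowerSeriesOnBall_zero (a : ℂ)).hasSum
    (y := z) (by simpa [enorm_eq_nnnorm] using! hz)
  have e (m : ℕ) : Ring.choose ((a : ℂ) + m - 1) m = (binomCoeff a m : ℂ) := by
    rw [← choose_eq_binomCoeff, Complex.ofReal_choose]
    push_cast
    rfl
  simpa [e, Complex.cpow_neg, mul_comm] using h

lemma summable_norm_binomCoeff (a : ℝ) {z : ℂ} (hz : ‖z‖ < 1) :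
    Summable fun m => ‖(binomCoeff a m : ℂ) * z ^ m‖ :=
  (hasSum_binomCoeff a hz).summable.norm

/-- The Taylor coefficients at `0` of `((3 - z) / 2) ^ (-α)`. -/
def smoothCoeff (α : ℝ) (i : ℕ) : ℝ := (3 / 2) ^ (-α) * (binomCoeff α i * (1 / 3) ^ i)

lemma smoothCoeff_pos {α : ℝ} (hα : 0 < α) (i : ℕ) : 0 < smoothCoeff α i := by
  have := binomCoeff_pos hα i
  unfold smoothCoeff; positivity

/-- The symbol of the quadrature, `((3 - z) (1 - z) / 2) ^ (-α)`, as a function of a complex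
variable. -/
def symbol (α : ℝ) (z : ℂ) : ℂ :=
  ((3 / 2 : ℝ) ^ (-α) : ℝ) * ((1 - z / 3) * (1 - z)) ^ (-(α : ℂ))

lemma norm_div_three_lt {z : ℂ} (hz : ‖z‖ < 1) : ‖z / 3‖ < 1 := by
  rw [norm_div]; norm_num; linarith

lemma re_one_sub_pos {z : ℂ} (hz : ‖z‖ < 1) : 0 < (1 - z).re := by
  have := (Complex.abs_re_le_norm z).trans_lt hz
  simp [(abs_lt.1 this).2]

/-- Both factors lie in the right half-plane, so their arguments add up to less than π in modulus
and the principal logarithm is additive. -/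
lemma one_sub_mul_cpow {z : ℂ} (hz : ‖z‖ < 1) (s : ℂ) :
    ((1 - z / 3) * (1 - z)) ^ s = (1 - z / 3) ^ s * (1 - z) ^ s := by
  have h1 := re_one_sub_pos hz
  have h2 := re_one_sub_pos (norm_div_three_lt hz)
  have n1 : (1 - z) ≠ 0 := by intro h; simp [h] at h1
  have n2 : (1 - z / 3) ≠ 0 := by intro h; simp [h] at h2
  have a1 := abs_lt.1 (Complex.abs_arg_lt_pi_div_two_iff.2 (Or.inl h1))
  have a2 := abs_lt.1 (Complex.abs_arg_lt_pi_div_two_iff.2 (Or.inl h2))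
  rw [Complex.cpow_def_of_ne_zero (mul_ne_zero n2 n1), Complex.cpow_def_of_ne_zero n1,
    Complex.cpow_def_of_ne_zero n2, (Complex.log_mul_eq_add_log_iff n2 n1).2
      ⟨by linarith [a1.1, a2.1], by linarith [a1.2, a2.2]⟩, ← Complex.exp_add]
  ring_nf

lemma hasSum_symbol (α : ℝ) {z : ℂ} (hz : ‖z‖ < 1) :
    HasSum (fun m => ((∑ p ∈ Finset.HasAntidiagonal.antidiagonal m,
      smoothCoeff α p.1 * binomCoeff α p.2 : ℝ) : ℂ) * z ^ m) (symbol α z) := by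
  have hz3 := norm_div_three_lt hz
  have hs := summable_norm_sum_mul_antidiagonal_of_summable_norm
    (summable_norm_binomCoeff α hz3) (summable_norm_binomCoeff α hz)
  have ht := tsum_mul_tsum_eq_tsum_sum_antidiagonal_of_summable_norm
    (summable_norm_binomCoeff α hz3) (summable_norm_binomCoeff α hz)
  rw [(hasSum_binomCoeff α hz3).tsum_eq, (hasSum_binomCoeff α hz).tsum_eq,
    ← one_sub_mul_cpow hz] at ht
  have h := hs.of_norm.hasSum
  rw [← ht] at h
  refine (h.mul_left (((3 / 2 : ℝ) ^ (-α) : ℝ) : ℂ)).congr_fun ?_ 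
  intro m
  push_cast
  rw [Finset.mul_sum, Finset.sum_mul]
  refine Finset.sum_congr rfl fun p hp => ?_
  rw [← Finset.HasAntidiagonal.mem_antidiagonal.1 hp, smoothCoeff, pow_add]
  push_cast
  ring

lemma symbol_ofReal (α : ℝ) {x : ℝ} (hx : |x| < 1) :
    symbol α x = (((3 - x) * (1 - x) / 2) ^ (-α) : ℝ) := by
  have h := abs_lt.1 hx
  have h1 : 0 ≤ (1 - x / 3) * (1 - x) := mul_nonneg (by linarith [h.2]) (by linarith [h.2])
  rw [show (3 - x) * (1 - x) / 2 = (3 / 2) * ((1 - x / 3) * (1 - x)) by ring,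
    Real.mul_rpow (by norm_num) h1, symbol]
  push_cast
  rw [Complex.ofReal_cpow h1]
  push_cast
  rfl

lemma hasSum_symbol_real (α : ℝ) {x : ℝ} (hx : |x| < 1) :
    HasSum (fun m => (∑ p ∈ Finset.HasAntidiagonal.antidiagonal m,
      smoothCoeff α p.1 * binomCoeff α p.2) * x ^ m) (((3 - x) * (1 - x) / 2) ^ (-α)) := by
  have h := hasSum_symbol α (z := x) (by simpa using hx)
  rw [symbol_ofReal α hx] at h
  exact_mod_cast h

/-- Uniqueness of Taylor coefficients, on a ball of radius 1/2 (any radius below 1 would serve). It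
replaces derivatives by a convolution in which `binomCoeff` carries the singularity at z = 1 and
`smoothCoeff` decays geometrically. -/
lemma cqWeight_eq (α : ℝ) (m : ℕ) :
    cqWeight α m = ∑ p ∈ Finset.HasAntidiagonal.antidiagonal m, smoothCoeff α p.1 * binomCoeff α p.2 := by
  set w : ℕ → ℝ := fun m => ∑ p ∈ Finset.HasAntidiagonal.antidiagonal m, smoothCoeff α p.1 * binomCoeff α p.2
  have hp : HasFPowerSeriesOnBall (fun z : ℝ => ((3 - z) * (1 - z) / 2) ^ (-α))
      (FormalMultilinearSeries.ofScalars ℝ w) 0 ((1 / 2 : NNReal) : ℝ≥0∞) := by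
    refine ⟨?_, by simp, ?_⟩
    · refine FormalMultilinearSeries.le_radius_of_summable _ ?_
      have := (hasSum_symbol_real α (x := 1 / 2) (by norm_num [abs_lt])).summable.norm
      refine this.congr fun m => ?_
      rw [FormalMultilinearSeries.ofScalars_norm, norm_mul]
      simp [w]
    · intro y hy
      have hy' : |y| < 1 := by
        have h : ‖y‖₊ < 1 / 2 := by
          rw [Metric.mem_eball, edist_zero_right, enorm_eq_nnnorm] at hy
          exact_mod_cast hy
        have h' : ‖y‖ < 1 / 2 := by exact_mod_cast h
        rw [← Real.norm_eq_abs]; linarith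
      simpa [mul_comm, w] using hasSum_symbol_real α hy'
  have h := hp.factorial_smul 1 m
  rw [cqWeight, iteratedDeriv_eq_iteratedFDeriv, ← h]
  simp
  field_simp
  rfl

lemma cqWeight_pos {α : ℝ} (hα : 0 < α) (m : ℕ) : 0 < cqWeight α m := by
  rw [cqWeight_eq]
  exact Finset.sum_pos (fun p _ => mul_pos (smoothCoeff_pos hα _) (binomCoeff_pos hα _))
    ⟨(0, m), by simp⟩

lemma hasSum_cqWeight (α : ℝ) {z : ℂ} (hz : ‖z‖ < 1) :
    HasSum (fun m => (cqWeight α m : ℂ) * z ^ m) (symbol α z) := by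
  simpa only [cqWeight_eq] using hasSum_symbol α hz

/-! ### Positivity of the real part of the symbol. -/

/-- With z = x + iy, the real part is (1 - x/3)(1 - x) - y^2/3, and y^2 < 1 - x^2 makes it larger
than (2/3)(1 - x)^2. This is the A-stability of BDF2. -/
lemma symbolBase_re_pos {z : ℂ} (hz : ‖z‖ < 1) : 0 < ((1 - z / 3) * (1 - z)).re := by
  have h1 : z.re ^ 2 + z.im ^ 2 < 1 := by
    have := Complex.sq_norm z
    rw [Complex.normSq_apply] at this
    nlinarith [norm_nonneg z]
  have h2 := re_one_sub_pos hz
  have e : ((1 - z / 3) * (1 - z)).re = (1 - z.re / 3) * (1 - z.re) - z.im ^ 2 / 3 := by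
    simp [Complex.mul_re, Complex.div_ofNat_re, Complex.div_ofNat_im]
    ring
  rw [e]
  nlinarith [sq_nonneg (1 - z.re)]

/-- The base has argument below π/2 in modulus, and the power -α multiplies the argument by -α with
α < 1. -/
lemma re_symbol_nonneg {α : ℝ} (hα₀ : 0 < α) (hα₁ : α < 1) {z : ℂ} (hz : ‖z‖ < 1) :
    0 ≤ (symbol α z).re := by
  have hq := symbolBase_re_pos hz
  set q : ℂ := (1 - z / 3) * (1 - z)
  have hq0 : q ≠ 0 := by intro h; simp [h] at hq
  have harg := abs_lt.1 (Complex.abs_arg_lt_pi_div_two_iff.2 (Or.inl hq))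
  have hc : 0 ≤ (q ^ (-(α : ℂ))).re := by
    rw [Complex.cpow_def_of_ne_zero hq0, Complex.exp_re]
    refine mul_nonneg (Real.exp_pos _).le (Real.cos_nonneg_of_mem_Icc ?_)
    have : (Complex.log q * -(α : ℂ)).im = - (α * q.arg) := by
      simp [Complex.log_im, mul_comm]
    rw [this]
    constructor <;> nlinarith [harg.1, harg.2, Real.pi_pos]
  rw [symbol, Complex.re_ofReal_mul]
  exact mul_nonneg (by positivity) hc

/-! ### Recurrences and asymptotics of the binomial coefficients. -/

lemma mul_binomCoeff_add_one (a : ℝ) (m : ℕ) :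
    a * binomCoeff (a + 1) m = binomCoeff a m * (a + m) := by
  induction m with
  | zero => simp
  | succ m ih =>
    rw [binomCoeff_succ, binomCoeff_succ, ← mul_assoc, ih]
    push_cast
    field_simp
    ring

lemma binomCoeff_succ_mul (a : ℝ) (m : ℕ) :
    binomCoeff a (m + 1) * (m + 1) = a * binomCoeff (a + 1) m := by
  rw [mul_binomCoeff_add_one, binomCoeff_succ]
  field_simp

/-- Coefficient form of (1 - z)(1 - z)^(-(a+1)) = (1 - z)^(-a): a backward difference lowers the
exponent by one. -/
lemma binomCoeff_add_one_sub {a : ℝ} (ha : 0 < a) (m : ℕ) :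
    binomCoeff (a + 1) (m + 1) - binomCoeff (a + 1) m = binomCoeff a (m + 1) := by
  have h1 := mul_binomCoeff_add_one a (m + 1)
  have h2 := binomCoeff_succ_mul a m
  push_cast at h1
  refine mul_left_cancel₀ ha.ne' ?_
  rw [mul_sub, h1, ← h2]
  ring

lemma binomCoeff_le_one {a : ℝ} (ha : 0 < a) (ha1 : a ≤ 1) (m : ℕ) : binomCoeff a m ≤ 1 :=
  Finset.prod_le_one (fun i _ => by positivity) fun i _ => by
    rw [div_le_one (by positivity)]; linarith

/-- `binomCoeff a` extended by zero to negative indices. -/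
def binomCoeffInt (a : ℝ) (n : ℤ) : ℝ := if 0 ≤ n then binomCoeff a n.toNat else 0

lemma binomCoeffInt_natCast (a : ℝ) (n : ℕ) : binomCoeffInt a n = binomCoeff a n := by
  simp [binomCoeffInt]

lemma binomCoeffInt_of_neg (a : ℝ) {n : ℤ} (hn : n < 0) : binomCoeffInt a n = 0 := by
  simp [binomCoeffInt, hn]

lemma binomCoeffInt_sub_one {a : ℝ} (ha : 0 < a) (n : ℤ) :
    binomCoeffInt (a + 1) (n - 1) = binomCoeffInt (a + 1) n - binomCoeffInt a n := by
  rcases lt_trichotomy n 0 with h | rfl | h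
  · rw [binomCoeffInt_of_neg _ h, binomCoeffInt_of_neg _ h, binomCoeffInt_of_neg _ (by omega),
      sub_zero]
  · simp [binomCoeffInt]
  · obtain ⟨m, rfl⟩ : ∃ m : ℕ, n = (m + 1 : ℕ) := ⟨(n - 1).toNat, by omega⟩
    rw [show ((m + 1 : ℕ) : ℤ) - 1 = (m : ℕ) by push_cast; ring, binomCoeffInt_natCast,
      binomCoeffInt_natCast, binomCoeffInt_natCast, ← binomCoeff_add_one_sub ha]
    ring

lemma log_one_add_bounds {t : ℝ} (ht : 0 ≤ t) : |Real.log (1 + t) - t + t ^ 2 / 2| ≤ t ^ 3 := by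
  have hlow : 0 ≤ Real.log (1 + t) - t + t ^ 2 / 2 := by
    have h := Real.le_log_one_add_of_nonneg ht
    have : 2 * t / (t + 2) - t + t ^ 2 / 2 = t ^ 3 / (2 * (t + 2)) := by
      field_simp; ring
    have h2 : 0 ≤ t ^ 3 / (2 * (t + 2)) := by positivity
    linarith
  have hup : MonotoneOn (fun t : ℝ => t ^ 3 - (Real.log (1 + t) - t + t ^ 2 / 2)) (Ici 0) := by
    have hd (x : ℝ) (hx : 0 ≤ x) : HasDerivAt
        (fun t : ℝ => t ^ 3 - (Real.log (1 + t) - t + t ^ 2 / 2))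
        (3 * x ^ 2 - (1 / (1 + x) - 1 + x)) x := by
      have h1 : HasDerivAt (fun t : ℝ => Real.log (1 + t)) (1 / (1 + x)) x :=
        ((hasDerivAt_id x).const_add 1).log (by positivity)
      have h2 := (hasDerivAt_pow 3 x).sub ((h1.sub (hasDerivAt_id x)).add
        ((hasDerivAt_pow 2 x).div_const 2))
      convert! h2 using 1
      norm_num
    refine monotoneOn_of_deriv_nonneg (convex_Ici 0)
      (fun x hx => (hd x hx).continuousAt.continuousWithinAt) ?_ ?_
    · intro x hx
      rw [interior_Ici] at hx
      exact (hd x (le_of_lt hx)).differentiableAt.differentiableWithinAt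
    · intro x hx
      rw [interior_Ici] at hx
      have hx : 0 < x := hx
      rw [(hd x hx.le).deriv]
      have : 3 * x ^ 2 - (1 / (1 + x) - 1 + x) = x ^ 2 * (3 - 1 / (1 + x)) := by
        field_simp; ring
      rw [this]
      have h1 : 1 / (1 + x) ≤ 1 := by rw [div_le_one (by positivity)]; linarith
      exact mul_nonneg (sq_nonneg x) (by linarith)
  have := hup (mem_Ici.2 le_rfl) (mem_Ici.2 ht) ht
  norm_num at this
  rw [abs_of_nonneg hlow]
  linarith

/-- Summation of the increments from m to infinity: a m + 2D/m^2 is antitone because 2D/m^2 drops by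
at least D/m^3 per step, and its limit is 0. -/
lemma neg_div_sq_le_of_sub_le {a : ℕ → ℝ} {D : ℝ} (hD : 0 ≤ D) (ha : Tendsto a atTop (𝓝 0))
    (h : ∀ m ≥ 1, a (m + 1) - a m ≤ D / m ^ 3) {m : ℕ} (hm : 1 ≤ m) :
    -(2 * D / m ^ 2) ≤ a m := by
  set s : ℕ → ℝ := fun m => a (m + 1) + 2 * D / ((m : ℝ) + 1) ^ 2
  have hanti : Antitone s := by
    refine antitone_nat_of_succ_le fun n => ?_
    have h1 := h (n + 1) (by omega)
    have h2 : D / ((n : ℝ) + 1) ^ 3 ≤ 2 * D / ((n : ℝ) + 1) ^ 2 - 2 * D / ((n : ℝ) + 1 + 1) ^ 2 := by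
      have : 2 * D / ((n : ℝ) + 1) ^ 2 - 2 * D / ((n : ℝ) + 1 + 1) ^ 2 - D / ((n : ℝ) + 1) ^ 3
          = D * (3 * n ^ 2 + 6 * n + 2) / (((n : ℝ) + 1) ^ 3 * ((n : ℝ) + 1 + 1) ^ 2) := by
        field_simp; ring
      have h3 : 0 ≤ D * (3 * n ^ 2 + 6 * n + 2) /
          (((n : ℝ) + 1) ^ 3 * ((n : ℝ) + 1 + 1) ^ 2) := by positivity
      linarith
    simp only [s]
    push_cast at h1 ⊢
    linarith
  have hlim : Tendsto s atTop (𝓝 0) := by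
    have h1 := ha.comp (tendsto_add_atTop_nat 1)
    have h2 : Tendsto (fun n : ℕ => 2 * D / ((n : ℝ) + 1) ^ 2) atTop (𝓝 0) :=
      Tendsto.div_atTop tendsto_const_nhds
        ((tendsto_pow_atTop two_ne_zero).comp
          (tendsto_atTop_add_const_right _ _ tendsto_natCast_atTop_atTop))
    simpa using h1.add h2
  have h0 := hanti.le_of_tendsto hlim (m - 1)
  simp only [s] at h0
  rw [Nat.sub_add_cancel hm, Nat.cast_sub hm] at h0
  push_cast at h0
  rw [sub_add_cancel] at h0
  linarith

lemma abs_le_of_abs_sub_le {a : ℕ → ℝ} {D : ℝ} (hD : 0 ≤ D) (ha : Tendsto a atTop (𝓝 0))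
    (h : ∀ m ≥ 1, |a (m + 1) - a m| ≤ D / m ^ 3) {m : ℕ} (hm : 1 ≤ m) :
    |a m| ≤ 2 * D / m ^ 2 := by
  refine abs_le.2 ⟨neg_div_sq_le_of_sub_le hD ha (fun m hm => (abs_le.1 (h m hm)).2) hm, ?_⟩
  have := neg_div_sq_le_of_sub_le (a := fun m => -a m) hD (by simpa using ha.neg)
    (fun m hm => by linarith [(abs_le.1 (h m hm)).1]) hm
  linarith

/-- The coefficients are, up to explicit factors, the reciprocals of the Euler sequence converging
to Γ(a); this is where the constant Γ(α) of the asymptotics comes from. -/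
lemma binomCoeff_mul_gammaSeq {a : ℝ} (ha : 0 < a) (m : ℕ) :
    binomCoeff a m * (a + m) * Real.GammaSeq a m = (m : ℝ) ^ a := by
  have h : binomCoeff a m * (a + m) * m.factorial = ∏ j ∈ Finset.range (m + 1), (a + j) := by
    rw [Finset.prod_range_succ]
    have : binomCoeff a m * m.factorial = ∏ j ∈ Finset.range m, (a + j) := by
      induction m with
      | zero => simp
      | succ m ih =>
        rw [Finset.prod_range_succ, ← ih, binomCoeff_succ, Nat.factorial_succ]
        push_cast
        field_simp
    rw [← this]
    ring
  have hp : (∏ j ∈ Finset.range (m + 1), (a + j)) ≠ 0 :=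
    (Finset.prod_pos fun j _ => by positivity).ne'
  rw [Real.GammaSeq, mul_div_assoc', div_eq_iff hp, ← h]
  ring

/-- Logarithm of the ratio between `binomCoeff α m` and its second order asymptotic
approximation. -/
def logRatio (α : ℝ) (m : ℕ) : ℝ :=
  Real.log (Real.Gamma α * binomCoeff α m * (m + α * (1 - α) / 2)) - α * Real.log m

lemma tendsto_logRatio {α : ℝ} (hα₀ : 0 < α) (hα₁ : α < 1) :
    Tendsto (logRatio α) atTop (𝓝 0) := by
  set c := α * (1 - α) / 2
  have hc : 0 < c := by have : 0 < 1 - α := by linarith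
                        positivity
  have hG := Real.Gamma_pos_of_pos hα₀
  have h1 : Tendsto (fun m => Real.Gamma α / Real.GammaSeq α m) atTop (𝓝 1) := by
    have := (tendsto_const_nhds (x := Real.Gamma α)).div (Real.GammaSeq_tendsto_Gamma α) hG.ne'
    rwa [div_self hG.ne'] at this
  have h2 : Tendsto (fun m : ℕ => ((m : ℝ) + c) / (m + α)) atTop (𝓝 1) := by
    have : Tendsto (fun m : ℕ => 1 + (c - α) / ((m : ℝ) + α)) atTop (𝓝 (1 + 0)) :=
      tendsto_const_nhds.add (Tendsto.div_atTop tendsto_const_nhds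
        (tendsto_atTop_add_const_right _ _ tendsto_natCast_atTop_atTop))
    rw [add_zero] at this
    refine this.congr fun m => ?_
    field_simp
    ring
  have h3 := ((Real.continuousAt_log one_ne_zero).tendsto).comp
    (by simpa using h1.mul h2 : Tendsto _ atTop (𝓝 (1 : ℝ)))
  rw [Real.log_one] at h3
  refine h3.congr' ?_
  filter_upwards [eventually_ge_atTop 1] with m hm
  have hm' : (0 : ℝ) < m := by exact_mod_cast hm
  have hb := binomCoeff_pos hα₀ m
  have hgs := binomCoeff_mul_gammaSeq hα₀ m
  have hgs0 : Real.GammaSeq α m ≠ 0 := by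
    intro h; rw [h, mul_zero] at hgs
    exact (Real.rpow_pos_of_pos hm' α).ne hgs
  rw [logRatio, ← Real.log_rpow hm', ← Real.log_div (by positivity) (by positivity), ← hgs,
    Function.comp_apply]
  congr 1
  rw [show Real.Gamma α * binomCoeff α m * ((m : ℝ) + α * (1 - α) / 2) =
    Real.Gamma α * binomCoeff α m * (m + c) from rfl]
  field_simp
  rw [add_comm α]

/-- In powers of y = 1/m the first order terms of the increment cancel for every shift c, and the
second order terms cancel exactly for c = α(1 - α)/2. What remains is at most five cubic remainders
of size 8 y^3. -/
lemma abs_logRatio_sub_le {α : ℝ} (hα₀ : 0 < α) (hα₁ : α < 1) (m : ℕ) (hm : 1 ≤ m) :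
    |logRatio α (m + 1) - logRatio α m| ≤ 40 / m ^ 3 := by
  set c := α * (1 - α) / 2 with hcdef
  have hc : 0 < c := by have : 0 < 1 - α := by linarith
                        positivity
  have hc1 : c ≤ 1 := by nlinarith
  have hG := Real.Gamma_pos_of_pos hα₀
  have hm' : (1 : ℝ) ≤ m := by exact_mod_cast hm
  have hb := binomCoeff_pos hα₀ m
  set y : ℝ := 1 / m with hy
  have hy0 : 0 < y := by positivity
  have hL (x : ℝ) (hx : 0 ≤ x) : Real.log (m + x) = Real.log m + Real.log (1 + x * y) := by
    rw [← Real.log_mul (by positivity) (by positivity)]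
    congr 1
    rw [hy]; field_simp
  have e : logRatio α (m + 1) - logRatio α m =
      Real.log (1 + α * y) + Real.log (1 + (1 + c) * y) - Real.log (1 + 1 * y)
        - Real.log (1 + c * y) - α * Real.log (1 + 1 * y) := by
    rw [logRatio, logRatio, binomCoeff_succ]
    push_cast
    rw [Real.log_mul (by positivity) (by positivity), Real.log_mul (by positivity) (by positivity),
      Real.log_mul (by positivity) (by positivity), Real.log_div (by positivity) (by positivity),
      Real.log_mul (by positivity) (by positivity), Real.log_mul (by positivity) (by positivity),
      add_assoc (m : ℝ) 1, add_comm α, ← hcdef, hL α hα₀.le, hL 1 zero_le_one, hL c hc.le,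
      hL (1 + c) (by positivity)]
    ring
  have hB (x : ℝ) (hx : 0 ≤ x) (hx2 : x ≤ 2) :
      |Real.log (1 + x * y) - x * y + (x * y) ^ 2 / 2| ≤ 8 * y ^ 3 := by
    refine (log_one_add_bounds (by positivity)).trans ?_
    rw [mul_pow]
    have : x ^ 3 ≤ 2 ^ 3 := pow_le_pow_left₀ hx hx2 3
    nlinarith [pow_pos hy0 3]
  have b1 := abs_le.1 (hB α hα₀.le (by linarith))
  have b2 := abs_le.1 (hB (1 + c) (by positivity) (by linarith))
  have b3 := abs_le.1 (hB 1 (by positivity) (by linarith))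
  have b4 := abs_le.1 (hB c hc.le (by linarith))
  have hy3 : 40 / (m : ℝ) ^ 3 = 40 * y ^ 3 := by rw [hy]; field_simp
  -- Vanishing of the y^2 coefficient; it is equivalent to the choice of c.
  have hq : α ^ 2 + (1 + c) ^ 2 - 1 - c ^ 2 - α = 0 := by rw [hcdef]; ring
  have hy3' := pow_pos hy0 3
  rw [e, hy3]
  set ra := Real.log (1 + α * y) - α * y + (α * y) ^ 2 / 2
  set rb := Real.log (1 + (1 + c) * y) - (1 + c) * y + ((1 + c) * y) ^ 2 / 2
  set rc := Real.log (1 + 1 * y) - 1 * y + (1 * y) ^ 2 / 2 with hrc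
  set rd := Real.log (1 + c * y) - c * y + (c * y) ^ 2 / 2
  have e2 : Real.log (1 + α * y) + Real.log (1 + (1 + c) * y) - Real.log (1 + 1 * y)
        - Real.log (1 + c * y) - α * Real.log (1 + 1 * y) = ra + rb - rc - rd - α * rc := by
    linear_combination (-y ^ 2 / 2) * hq
  have hrcα : |α * rc| ≤ 8 * y ^ 3 := by
    rw [abs_mul, abs_of_pos hα₀]
    have := abs_le.2 b3
    nlinarith [abs_nonneg rc]
  have b5 := abs_le.1 hrcα
  rw [e2]
  exact abs_le.2 ⟨by linarith [b1.1, b2.1, b3.2, b4.2, b5.2],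
    by linarith [b1.2, b2.2, b3.1, b4.1, b5.1]⟩

/-- Second order asymptotics of the binomial coefficients. -/
lemma exists_binomCoeff_asymp {α : ℝ} (hα₀ : 0 < α) (hα₁ : α < 1) :
    ∃ K : ℝ, 0 < K ∧ ∀ m : ℕ, 1 ≤ m →
      |Real.Gamma α * binomCoeff α m * (m + α * (1 - α) / 2) - (m : ℝ) ^ α| ≤
        K * (m : ℝ) ^ (α - 2) := by
  -- Increments of size 40/m^3 give |logRatio| ≤ 80/m^2 ≤ 80, and then |exp x - 1| ≤ |x| exp 80.
  refine ⟨80 * Real.exp 80, by positivity, fun m hm => ?_⟩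
  set c := α * (1 - α) / 2 with hcdef
  have hc : 0 < c := by have : 0 < 1 - α := by linarith
                        positivity
  have hG := Real.Gamma_pos_of_pos hα₀
  have hm' : (1 : ℝ) ≤ m := by exact_mod_cast hm
  have hm0 : (0 : ℝ) < m := by linarith
  have hb := binomCoeff_pos hα₀ m
  have h := abs_le_of_abs_sub_le (by norm_num) (tendsto_logRatio hα₀ hα₁)
    (fun m hm => abs_logRatio_sub_le hα₀ hα₁ m hm) hm
  norm_num at h
  set x := logRatio α m with hx
  have hexp : Real.Gamma α * binomCoeff α m * (m + c) = (m : ℝ) ^ α * Real.exp x := by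
    rw [hx, logRatio, ← Real.log_rpow hm0, ← Real.log_div (by positivity) (by positivity),
      Real.exp_log (by positivity), ← hcdef]
    field_simp
  have h80 : |x| ≤ 80 := h.trans (div_le_self (by norm_num) (one_le_pow₀ hm'))
  have hx1 : |Real.exp x - 1| ≤ |x| * Real.exp 80 := by
    have h1 := Real.add_one_le_exp x
    have h2 : Real.exp x - 1 ≤ x * Real.exp x := by
      have := Real.add_one_le_exp (-x)
      have h3 : Real.exp (-x) * Real.exp x = 1 := by rw [← Real.exp_add]; simp
      nlinarith [Real.exp_pos x]
    have h3 : x * Real.exp x ≤ |x| * Real.exp 80 :=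
      mul_le_mul (le_abs_self x) (Real.exp_le_exp.2 ((le_abs_self x).trans h80))
        (Real.exp_pos x).le (abs_nonneg x)
    have h4 : |x| ≤ |x| * Real.exp 80 :=
      le_mul_of_one_le_right (abs_nonneg x) (Real.one_le_exp (by norm_num))
    exact abs_le.2 ⟨by linarith [neg_abs_le x], by linarith⟩
  rw [hexp, show (m : ℝ) ^ α * Real.exp x - (m : ℝ) ^ α = (m : ℝ) ^ α * (Real.exp x - 1) by ring,
    abs_mul, abs_of_pos (Real.rpow_pos_of_pos hm0 _), Real.rpow_sub hm0]
  norm_num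
  calc (m : ℝ) ^ α * |Real.exp x - 1| ≤ (m : ℝ) ^ α * (80 / m ^ 2 * Real.exp 80) := by
        gcongr
        exact hx1.trans (by gcongr)
    _ = _ := by ring

lemma rpow_div_le {s x l : ℝ} (hs : -1 ≤ s) (hx : 0 < x) (hl : 1 ≤ l) :
    (x / l) ^ s ≤ l * x ^ s := by
  rw [Real.div_rpow hx.le (by linarith), div_eq_mul_inv, ← Real.rpow_neg (by linarith), mul_comm]
  gcongr
  calc l ^ (-s) ≤ l ^ (1 : ℝ) := Real.rpow_le_rpow_of_exponent_le hl (by linarith)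
    _ = l := Real.rpow_one l

lemma exists_binomCoeff_le {α : ℝ} (hα₀ : 0 < α) (hα₁ : α < 1) :
    ∃ C : ℝ, 0 < C ∧ ∀ m : ℕ, binomCoeff α m ≤ C * ((m : ℝ) + 1) ^ (α - 1) := by
  obtain ⟨K, hK, h⟩ := exists_binomCoeff_asymp hα₀ hα₁
  have hG := Real.Gamma_pos_of_pos hα₀
  refine ⟨1 + 2 * ((1 + K) / Real.Gamma α), by positivity, fun m => ?_⟩
  rcases Nat.eq_zero_or_pos m with rfl | hm
  · simp only [binomCoeff_zero, Nat.cast_zero, zero_add, Real.one_rpow, mul_one]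
    have : 0 < 2 * ((1 + K) / Real.Gamma α) := by positivity
    linarith
  have hm' : (1 : ℝ) ≤ m := by exact_mod_cast hm
  have hm0 : (0 : ℝ) < m := by linarith
  have hb := binomCoeff_pos hα₀ m
  have h1 := (abs_le.1 (h m hm)).2
  have hc : 0 ≤ α * (1 - α) / 2 := by have : 0 < 1 - α := by linarith
                                      positivity
  have h2 : (m : ℝ) ^ (α - 2) ≤ (m : ℝ) ^ α :=
    Real.rpow_le_rpow_of_exponent_le hm' (by linarith)
  have h3 : Real.Gamma α * binomCoeff α m * m ≤ (1 + K) * (m : ℝ) ^ α := by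
    have : 0 ≤ Real.Gamma α * binomCoeff α m * (α * (1 - α) / 2) := by positivity
    nlinarith
  have h4 : binomCoeff α m ≤ (1 + K) / Real.Gamma α * (m : ℝ) ^ (α - 1) := by
    rw [Real.rpow_sub_one hm0.ne', div_mul_div_comm, le_div_iff₀ (by positivity)]
    linarith
  have h5 : (m : ℝ) ^ (α - 1) ≤ 2 * ((m : ℝ) + 1) ^ (α - 1) := by
    refine (Real.rpow_le_rpow_of_nonpos (by positivity) (?_ : ((m : ℝ) + 1) / 2 ≤ m)
      (by linarith)).trans (rpow_div_le (by linarith) (by positivity) one_le_two)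
    linarith
  have h6 : 0 < (1 + K) / Real.Gamma α := by positivity
  have h7 : 0 < ((m : ℝ) + 1) ^ (α - 1) := by positivity
  nlinarith

/-- Shifting the index by l costs only a factor l + 1, because m + 1 ≤ (l + 1)(m - l + 1) and the
exponent is at least -1. The geometric decay of `smoothCoeff` later absorbs such polynomial losses.
-/
lemma exists_binomCoeffInt_le {α : ℝ} (hα₀ : 0 < α) (hα₁ : α < 1) :
    ∃ C : ℝ, 0 < C ∧ ∀ m l : ℕ,
      |binomCoeffInt α ((m : ℤ) - l)| ≤ C * (l + 1) * ((m : ℝ) + 1) ^ (α - 1) := by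
  obtain ⟨C, hC, h⟩ := exists_binomCoeff_le hα₀ hα₁
  refine ⟨C, hC, fun m l => ?_⟩
  rcases lt_or_ge ((m : ℤ) - l) 0 with h0 | h0
  · rw [binomCoeffInt_of_neg _ h0, abs_zero]
    positivity
  obtain ⟨n, hn⟩ := Int.eq_ofNat_of_zero_le h0
  rw [hn, binomCoeffInt_natCast, abs_of_pos (binomCoeff_pos hα₀ n)]
  have hm : m = n + l := by omega
  have h1 : ((n : ℝ) + 1) ^ (α - 1) ≤ (l + 1) * ((m : ℝ) + 1) ^ (α - 1) := by
    refine (Real.rpow_le_rpow_of_nonpos (by positivity)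
      (?_ : ((m : ℝ) + 1) / ((l : ℝ) + 1) ≤ n + 1) (by linarith)).trans
      (rpow_div_le (by linarith) (by positivity) (by linarith [l.cast_nonneg (α := ℝ)]))
    rw [div_le_iff₀ (by positivity), hm]
    push_cast
    nlinarith [n.cast_nonneg (α := ℝ), l.cast_nonneg (α := ℝ)]
  calc binomCoeff α n ≤ C * ((n : ℝ) + 1) ^ (α - 1) := h n
    _ ≤ C * ((l + 1) * ((m : ℝ) + 1) ^ (α - 1)) := by gcongr
    _ = _ := by ring

/-- Discrete Taylor expansion: the backward difference of the coefficients of exponent α + 2 is that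
of exponent α + 1, whose own difference has size m^(α-1). Induction on the shift accumulates these
differences. -/
lemma exists_binomCoeffInt_taylor {α : ℝ} (hα₀ : 0 < α) (hα₁ : α < 1) :
    ∃ C : ℝ, 0 < C ∧ ∀ m i : ℕ,
      |binomCoeffInt (α + 1) ((m : ℤ) - i) - binomCoeffInt (α + 1) m| ≤
          C * (i * (i + 1)) * ((m : ℝ) + 1) ^ (α - 1) ∧
      |binomCoeffInt (α + 1 + 1) ((m : ℤ) - i) - (binomCoeffInt (α + 1 + 1) m
          - i * binomCoeffInt (α + 1) m)| ≤
          C * (i * (i + 1) ^ 2) * ((m : ℝ) + 1) ^ (α - 1) := by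
  obtain ⟨C, hC, h⟩ := exists_binomCoeffInt_le hα₀ hα₁
  refine ⟨C, hC, fun m i => ?_⟩
  have hP : 0 < C * ((m : ℝ) + 1) ^ (α - 1) := by positivity
  set P := C * ((m : ℝ) + 1) ^ (α - 1) with hPd
  induction i with
  | zero => simp
  | succ i ih =>
    obtain ⟨h1, h2⟩ := ih
    have h3 := h m i
    have e1 := binomCoeffInt_sub_one hα₀ ((m : ℤ) - i)
    have e2 := binomCoeffInt_sub_one (a := α + 1) (by linarith) ((m : ℤ) - i)
    rw [show (m : ℤ) - i - 1 = m - (i + 1 : ℕ) by push_cast; ring] at e1 e2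
    have q1 : C * (i * (i + 1)) * ((m : ℝ) + 1) ^ (α - 1) = P * (i * (i + 1)) := by rw [hPd]; ring
    have q2 : C * (i * (i + 1) ^ 2) * ((m : ℝ) + 1) ^ (α - 1) = P * (i * (i + 1) ^ 2) := by
      rw [hPd]; ring
    have q3 : C * (i + 1) * ((m : ℝ) + 1) ^ (α - 1) = P * (i + 1) := by rw [hPd]; ring
    rw [q1] at h1; rw [q2] at h2; rw [q3] at h3
    have hi := i.cast_nonneg (α := ℝ)
    have h1' := abs_le.1 h1
    have h2' := abs_le.1 h2
    have h3' := abs_le.1 h3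
    rw [e1, e2]
    push_cast
    constructor
    · rw [show C * (((i : ℝ) + 1) * (i + 1 + 1)) * ((m : ℝ) + 1) ^ (α - 1)
        = P * (i * (i + 1)) + P * (i + 1) + P * (i + 1) by rw [hPd]; ring]
      have : 0 ≤ P * ((i : ℝ) + 1) := by positivity
      exact abs_le.2 ⟨by linarith [h1'.1, h3'.2], by linarith [h1'.2, h3'.1]⟩
    · rw [show C * (((i : ℝ) + 1) * (i + 1 + 1) ^ 2) * ((m : ℝ) + 1) ^ (α - 1)
        = P * (i * (i + 1) ^ 2) + P * (i * (i + 1)) + P * (2 * i ^ 2 + 6 * i + 4) by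
          rw [hPd]; ring]
      have : 0 ≤ P * (2 * (i : ℝ) ^ 2 + 6 * i + 4) := by positivity
      exact abs_le.2 ⟨by linarith [h1'.2, h2'.1], by linarith [h1'.1, h2'.2]⟩

/-! ### Partial sums of the weights and the error on linear functions. -/

lemma hasSum_binomCoeff_third (a : ℝ) :
    HasSum (fun i => binomCoeff a i * (1 / 3) ^ i) ((2 / 3 : ℝ) ^ (-a)) := by
  have h := hasSum_binomCoeff a (z := ((1 / 3 : ℝ) : ℂ)) (by norm_num)
  have e : (1 - ((1 / 3 : ℝ) : ℂ)) ^ (-(a : ℂ)) = ((2 / 3 : ℝ) ^ (-a) : ℝ) := by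
    rw [Complex.ofReal_cpow (by norm_num)]
    congr 1 <;> push_cast <;> norm_num
  rw [e] at h
  exact_mod_cast h

lemma three_halves_rpow_mul (α : ℝ) : (3 / 2 : ℝ) ^ (-α) * (2 / 3) ^ (-α) = 1 := by
  rw [← Real.mul_rpow (by norm_num) (by norm_num)]
  norm_num

lemma hasSum_smoothCoeff (α : ℝ) : HasSum (smoothCoeff α) 1 := by
  have := (hasSum_binomCoeff_third α).mul_left ((3 / 2) ^ (-α))
  rwa [three_halves_rpow_mul] at this

/-- The derivative of ((3 - z)/2)^(-α) at z = 1. Together with the value 1 there, it fixes the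
affine approximation of convolutions with `smoothCoeff`. -/
lemma hasSum_mul_smoothCoeff (α : ℝ) : HasSum (fun i : ℕ => smoothCoeff α i * i) (α / 2) := by
  have h := (hasSum_binomCoeff_third (α + 1)).mul_left ((3 / 2) ^ (-α) * α / 3)
  refine (hasSum_nat_add_iff' 1).1 ?_
  have e : (3 / 2 : ℝ) ^ (-α) * α / 3 * (2 / 3) ^ (-(α + 1)) = α / 2 := by
    rw [show -(α + 1) = -α - 1 by ring, Real.rpow_sub_one (by norm_num)]
    linear_combination (α / 2) * three_halves_rpow_mul α
  rw [e] at h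
  simp only [Finset.range_one, Finset.sum_singleton, Nat.cast_zero, mul_zero, sub_zero]
  refine h.congr_fun fun i => ?_
  have := binomCoeff_succ_mul α i
  rw [smoothCoeff, pow_succ]
  push_cast
  linear_combination (3 / 2 : ℝ) ^ (-α) * (1 / 3) ^ i / 3 * this

lemma summable_smoothCoeff_mul {α : ℝ} (hα₀ : 0 < α) (hα₁ : α < 1) :
    Summable fun i : ℕ => smoothCoeff α i * ((i : ℝ) + 1) ^ 3 := by
  have h := ((summable_nat_add_iff 1).2 (summable_pow_mul_geometric_of_norm_lt_one 3
    (r := (1 / 3 : ℝ)) (by norm_num))).mul_left ((3 / 2) ^ (-α) * 3)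
  refine h.of_nonneg_of_le (fun i => mul_nonneg (smoothCoeff_pos hα₀ i).le (by positivity))
    fun i => ?_
  rw [smoothCoeff, pow_succ (1 / 3 : ℝ) i]
  push_cast
  have := binomCoeff_le_one hα₀ hα₁.le i
  calc (3 / 2 : ℝ) ^ (-α) * (binomCoeff α i * (1 / 3) ^ i) * ((i : ℝ) + 1) ^ 3
      ≤ (3 / 2 : ℝ) ^ (-α) * (1 * (1 / 3) ^ i) * ((i : ℝ) + 1) ^ 3 := by gcongr
    _ = _ := by ring

/-- Replacing `F (m - i)` in a smooth convolution by its affine approximation. -/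
lemma exists_abs_conv_smoothCoeff_sub_le {α : ℝ} (hα₀ : 0 < α) (hα₁ : α < 1) :
    ∃ C : ℝ, 0 < C ∧ ∀ (F : ℤ → ℝ) (m : ℕ) (D a : ℝ), 0 ≤ D → (∀ n < 0, F n = 0) →
      (∀ i : ℕ, |F ((m : ℤ) - i) - (F m - i * a)| ≤ D * ((i : ℝ) + 1) ^ 3) →
      |∑ i ∈ Finset.range (m + 1), smoothCoeff α i * F ((m : ℤ) - i) - (F m - α / 2 * a)| ≤
        C * D := by
  have hs := summable_smoothCoeff_mul hα₀ hα₁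
  refine ⟨∑' i : ℕ, smoothCoeff α i * ((i : ℝ) + 1) ^ 3,
    hs.tsum_pos (fun i => mul_nonneg (smoothCoeff_pos hα₀ i).le (by positivity)) 0
      (mul_pos (smoothCoeff_pos hα₀ 0) (by positivity)), fun F m D a hD hF h => ?_⟩
  -- Vanishing of F at negative indices lets the finite sum be read as a full series, to which the
  -- two moments 1 and α/2 apply without truncation error.
  have h1 : HasSum (fun i : ℕ => smoothCoeff α i * F ((m : ℤ) - i))
      (∑ i ∈ Finset.range (m + 1), smoothCoeff α i * F ((m : ℤ) - i)) := by
    refine hasSum_sum_of_ne_finset_zero fun i hi => ?_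
    rw [Finset.mem_range, not_lt] at hi
    rw [hF _ (by omega), mul_zero]
  have h2 := h1.sub (((hasSum_smoothCoeff α).mul_right (F m)).sub
    ((hasSum_mul_smoothCoeff α).mul_right a))
  rw [one_mul] at h2
  rw [← h2.tsum_eq, ← Real.norm_eq_abs]
  refine tsum_of_norm_bounded (hs.hasSum.mul_right D) fun i => ?_
  rw [show smoothCoeff α i * F ((m : ℤ) - i) - (smoothCoeff α i * F m - smoothCoeff α i * i * a)
    = smoothCoeff α i * (F ((m : ℤ) - i) - (F m - i * a)) by ring, norm_mul, Real.norm_eq_abs,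
    Real.norm_eq_abs, abs_of_pos (smoothCoeff_pos hα₀ i), mul_assoc, mul_comm _ D]
  exact mul_le_mul_of_nonneg_left (h i) (smoothCoeff_pos hα₀ i).le

lemma sum_smoothCoeff_range_eq (F : ℤ → ℝ) (hF : ∀ n < 0, F n = 0) (α : ℝ) {l M : ℕ} (h : l < M) :
    ∑ i ∈ Finset.range (l + 1), smoothCoeff α i * F ((l : ℤ) - i) =
      ∑ i ∈ Finset.range M, smoothCoeff α i * F ((l : ℤ) - i) := by
  refine Finset.sum_subset (Finset.range_mono h) fun i _ hi => ?_
  rw [Finset.mem_range, not_lt] at hi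
  rw [hF _ (by omega), mul_zero]

/-- Taking partial sums multiplies the generating function by 1/(1 - z), which affects only the
singular factor. -/
lemma sum_range_conv_smoothCoeff {a : ℝ} (ha : 0 < a) (α : ℝ) (m : ℕ) :
    ∑ l ∈ Finset.range (m + 1), ∑ i ∈ Finset.range (l + 1),
        smoothCoeff α i * binomCoeffInt a ((l : ℤ) - i) =
      ∑ i ∈ Finset.range (m + 1), smoothCoeff α i * binomCoeffInt (a + 1) ((m : ℤ) - i) := by
  induction m with
  | zero => simp [binomCoeffInt]
  | succ m ih =>
    rw [Finset.sum_range_succ, ih, sum_smoothCoeff_range_eq (binomCoeffInt (a + 1))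
      (fun n hn => binomCoeffInt_of_neg _ hn) α (Nat.lt_succ_of_lt (Nat.lt_succ_self m)),
      ← Finset.sum_add_distrib]
    refine Finset.sum_congr rfl fun i _ => ?_
    have := binomCoeffInt_sub_one ha (((m + 1 : ℕ) : ℤ) - i)
    rw [show ((m + 1 : ℕ) : ℤ) - i - 1 = m - i by push_cast; ring] at this
    rw [this]
    ring

lemma cqWeight_eq_sum_range (α : ℝ) (l : ℕ) :
    cqWeight α l =
      ∑ i ∈ Finset.range (l + 1), smoothCoeff α i * binomCoeffInt α ((l : ℤ) - i) := by
  rw [cqWeight_eq, Finset.Nat.sum_antidiagonal_eq_sum_range_succ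
    (f := fun i j => smoothCoeff α i * binomCoeff α j)]
  refine Finset.sum_congr rfl fun i hi => ?_
  rw [← Nat.cast_sub (Nat.lt_succ_iff.1 (Finset.mem_range.1 hi)), binomCoeffInt_natCast]

lemma sum_cqWeight_eq {α : ℝ} (hα₀ : 0 < α) (m : ℕ) :
    ∑ l ∈ Finset.range (m + 1), cqWeight α l =
      ∑ i ∈ Finset.range (m + 1), smoothCoeff α i * binomCoeffInt (α + 1) ((m : ℤ) - i) := by
  simp_rw [cqWeight_eq_sum_range]
  exact sum_range_conv_smoothCoeff hα₀ α m

lemma sum_sum_cqWeight_eq {α : ℝ} (hα₀ : 0 < α) (m : ℕ) :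
    ∑ q ∈ Finset.range (m + 1), ∑ l ∈ Finset.range (q + 1), cqWeight α l =
      ∑ i ∈ Finset.range (m + 1), smoothCoeff α i * binomCoeffInt (α + 1 + 1) ((m : ℤ) - i) := by
  simp_rw [sum_cqWeight_eq hα₀]
  exact sum_range_conv_smoothCoeff (by linarith) α m

/-- Summation by parts: m - l is the number of q with l ≤ q < m. -/
lemma sum_cqWeight_mul_affine (α θ : ℝ) (m : ℕ) :
    ∑ l ∈ Finset.range (m + 1), cqWeight α l * ((m : ℝ) - l + θ) =
      ∑ q ∈ Finset.range m, ∑ l ∈ Finset.range (q + 1), cqWeight α l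
        + θ * ∑ l ∈ Finset.range (m + 1), cqWeight α l := by
  induction m with
  | zero => simp [mul_comm]
  | succ m ih =>
    rw [Finset.sum_range_succ, Finset.sum_range_succ (fun q => ∑ l ∈ Finset.range (q + 1), _),
      Finset.sum_range_succ (fun l => cqWeight α l) (m + 1)]
    have : ∑ l ∈ Finset.range (m + 1), cqWeight α l * (((m + 1 : ℕ) : ℝ) - l + θ) =
        ∑ l ∈ Finset.range (m + 1), cqWeight α l * ((m : ℝ) - l + θ)
          + ∑ l ∈ Finset.range (m + 1), cqWeight α l := by
      rw [← Finset.sum_add_distrib]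
      refine Finset.sum_congr rfl fun l _ => ?_
      push_cast
      ring
    rw [this, ih]
    ring

/-- After division by x^(1+α), Bernoulli's inequality with exponent 1 + α gives the lower bound, and
with exponent α the upper one; the gap is αθ^2 x^(α-1). -/
lemma abs_add_rpow_sub_le {α x θ : ℝ} (hα₀ : 0 < α) (hα₁ : α < 1) (hx : 1 ≤ x) (hθ₀ : 0 ≤ θ)
    (hθ₁ : θ ≤ 1) :
    |(x + θ) ^ (1 + α) - (x ^ (1 + α) + (1 + α) * θ * x ^ α)| ≤ x ^ (α - 1) := by
  have hx0 : 0 < x := by linarith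
  set y := θ / x with hy
  have hy0 : 0 ≤ y := by positivity
  have e : (x + θ) ^ (1 + α) = x ^ (1 + α) * (1 + y) ^ (1 + α) := by
    rw [← Real.mul_rpow hx0.le (by positivity), hy]
    congr 1
    field_simp
  have hlow : 1 + (1 + α) * y ≤ (1 + y) ^ (1 + α) :=
    one_add_mul_self_le_rpow_one_add (by linarith) (by linarith)
  have hup : (1 + y) ^ (1 + α) ≤ 1 + (1 + α) * y + α * y ^ 2 := by
    rw [Real.rpow_one_add' (by positivity) (by linarith)]
    have := rpow_one_add_le_one_add_mul_self (s := y) (p := α) (by linarith) hα₀.le hα₁.le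
    nlinarith
  have e1 : x ^ (1 + α) = x ^ (α - 1) * x ^ 2 := by
    rw [← Real.rpow_natCast, ← Real.rpow_add hx0]; norm_num; congr 1; ring
  have e2 : x ^ α = x ^ (α - 1) * x := by
    rw [← Real.rpow_add_one hx0.ne']; norm_num
  have hxy : x * y = θ := by rw [hy]; field_simp
  have hP : 0 < x ^ (α - 1) := by positivity
  have e3 : (x + θ) ^ (1 + α) - (x ^ (1 + α) + (1 + α) * θ * x ^ α) =
      x ^ (α - 1) * (x ^ 2 * ((1 + y) ^ (1 + α) - (1 + (1 + α) * y))) := by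
    rw [e, e2, ← hxy, e1]; ring
  have h1 : 0 ≤ x ^ 2 * ((1 + y) ^ (1 + α) - (1 + (1 + α) * y)) :=
    mul_nonneg (by positivity) (by linarith)
  have h2 : x ^ 2 * ((1 + y) ^ (1 + α) - (1 + (1 + α) * y)) ≤ 1 := by
    calc x ^ 2 * ((1 + y) ^ (1 + α) - (1 + (1 + α) * y)) ≤ x ^ 2 * (α * y ^ 2) := by
          gcongr; linarith
      _ = α * θ ^ 2 := by rw [← hxy]; ring
      _ ≤ 1 := by nlinarith
  rw [e3, abs_of_nonneg (by positivity)]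
  nlinarith

/-- Error of the quadrature on (shifted) linear functions, in units of the step, away from the
left end point. -/
lemma exists_abs_sum_cqWeight_sub_le {α : ℝ} (hα₀ : 0 < α) (hα₁ : α < 1) :
    ∃ C : ℝ, 0 < C ∧ ∀ (m : ℕ) (θ : ℝ), 1 ≤ m → 0 ≤ θ → θ ≤ 1 →
      |∑ l ∈ Finset.range (m + 1), cqWeight α l * ((m : ℝ) - l + θ)
        - ((m : ℝ) + θ) ^ (1 + α) / Real.Gamma (2 + α)| ≤ C * ((m : ℝ) + θ) ^ (α - 1) := by
  obtain ⟨C₁, hC₁, hT⟩ := exists_binomCoeffInt_taylor hα₀ hα₁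
  obtain ⟨C₂, hC₂, hS⟩ := exists_abs_conv_smoothCoeff_sub_le hα₀ hα₁
  obtain ⟨K, hK, hA⟩ := exists_binomCoeff_asymp hα₀ hα₁
  obtain ⟨C₃, hC₃, hB⟩ := exists_binomCoeff_le hα₀ hα₁
  have hG := Real.Gamma_pos_of_pos hα₀
  have hG2 : Real.Gamma (2 + α) = α * (α + 1) * Real.Gamma α := by
    rw [show 2 + α = α + 1 + 1 by ring, Real.Gamma_add_one (by linarith),
      Real.Gamma_add_one hα₀.ne']
    ring
  have hG2p : 0 < Real.Gamma (2 + α) := Real.Gamma_pos_of_pos (by linarith)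
  refine ⟨2 * (2 * (C₂ * C₁) + (3 * K + 2 * Real.Gamma α * C₃ + 1) / Real.Gamma (2 + α)),
    by positivity, ?_⟩
  rintro (_ | m) θ hm hθ₀ hθ₁
  · omega
  set x : ℝ := ((m + 1 : ℕ) : ℝ) with hx
  have hx1 : 1 ≤ x := by rw [hx]; exact_mod_cast hm
  have hx0 : 0 < x := by linarith
  have hxm : (m : ℝ) + 1 = x := by rw [hx]; push_cast; ring
  set P := x ^ (α - 1) with hP
  have hP0 : 0 < P := by positivity
  have hi (i : ℕ) : (i : ℝ) * (i + 1) ≤ ((i : ℝ) + 1) ^ 3 := by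
    have := i.cast_nonneg (α := ℝ); nlinarith [sq_nonneg (i : ℝ)]
  -- the two convolutions are close to their affine approximations
  have hV : |∑ i ∈ Finset.range (m + 1), smoothCoeff α i * binomCoeffInt (α + 1 + 1) ((m : ℤ) - i)
      - (binomCoeff (α + 1 + 1) m - α / 2 * binomCoeff (α + 1) m)| ≤ C₂ * C₁ * P := by
    have := hS (binomCoeffInt (α + 1 + 1)) m (C₁ * P) (binomCoeff (α + 1) m) (by positivity)
      (fun n hn => binomCoeffInt_of_neg _ hn) fun i => by
        have := (hT m i).2
        rw [hxm, ← hP, binomCoeffInt_natCast (α + 1)] at this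
        refine this.trans ?_
        have h3 : (i : ℝ) * (i + 1) ^ 2 ≤ ((i : ℝ) + 1) ^ 3 := by
          have := i.cast_nonneg (α := ℝ); nlinarith [sq_nonneg ((i : ℝ) + 1)]
        calc _ ≤ C₁ * ((i : ℝ) + 1) ^ 3 * P := by gcongr
          _ = _ := by ring
    rw [binomCoeffInt_natCast, ← mul_assoc] at this
    exact this
  have hY : |∑ i ∈ Finset.range (m + 1 + 1),
      smoothCoeff α i * binomCoeffInt (α + 1) (((m + 1 : ℕ) : ℤ) - i)
      - binomCoeff (α + 1) (m + 1)| ≤ C₂ * C₁ * P := by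
    have := hS (binomCoeffInt (α + 1)) (m + 1) (C₁ * P) 0 (by positivity)
      (fun n hn => binomCoeffInt_of_neg _ hn) fun i => by
        have := (hT (m + 1) i).1
        rw [← hx] at this
        rw [mul_zero, sub_zero]
        refine this.trans ?_
        have h3 : (x + 1) ^ (α - 1) ≤ P :=
          Real.rpow_le_rpow_of_nonpos hx0 (by linarith) (by linarith)
        calc _ ≤ C₁ * ((i : ℝ) + 1) ^ 3 * P := by gcongr; exact hi i
          _ = _ := by ring
    rw [binomCoeffInt_natCast, ← mul_assoc, mul_zero, sub_zero] at this
    exact this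
  rw [sum_cqWeight_mul_affine, sum_sum_cqWeight_eq hα₀, sum_cqWeight_eq hα₀]
  set V := ∑ i ∈ Finset.range (m + 1), smoothCoeff α i * binomCoeffInt (α + 1 + 1) ((m : ℤ) - i)
  set Y := ∑ i ∈ Finset.range (m + 1 + 1),
      smoothCoeff α i * binomCoeffInt (α + 1) (((m + 1 : ℕ) : ℤ) - i)
  -- exact formulas for the affine approximations
  set b := binomCoeff α (m + 1) with hb
  have hb0 : 0 < b := binomCoeff_pos hα₀ _
  have f1 : α * binomCoeff (α + 1) m = b * x := by
    rw [hb, ← hxm, binomCoeff_succ_mul]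
  have f2 : α * binomCoeff (α + 1) (m + 1) = b * (α + x) := mul_binomCoeff_add_one α (m + 1)
  have f3 : α * (α + 1) * binomCoeff (α + 1 + 1) m = b * x * (α + x) := by
    have := mul_binomCoeff_add_one (α + 1) m
    rw [mul_assoc, this, ← mul_assoc, f1, ← hxm]
    ring
  set c := α * (1 - α) / 2 with hc
  have hα2 : 0 ≤ α * (1 - α) := mul_nonneg hα₀.le (by linarith)
  have hα3 : α * (1 - α) ≤ α := mul_le_of_le_one_right hα₀.le (by linarith)
  -- The moment α/2 turns x + α into x + α - α(α + 1)/2 = x + c, precisely the shift of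
  -- `exists_binomCoeff_asymp`. The second order of the quadrature rests on this match.
  have f4 : Real.Gamma (2 + α) * (binomCoeff (α + 1 + 1) m - α / 2 * binomCoeff (α + 1) m) =
      (Real.Gamma α * b * (x + c)) * x := by
    rw [hG2, hc]
    linear_combination Real.Gamma α * f3 - Real.Gamma α * α * (α + 1) / 2 * f1
  -- The single partial sum comes without a factor x, so the mismatch α - c between its shift and c
  -- is harmless: it contributes O(x^(α-1)).
  have f5 : Real.Gamma (2 + α) * binomCoeff (α + 1) (m + 1) =
      (α + 1) * (Real.Gamma α * b * (x + c) + Real.Gamma α * b * (α - c)) := by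
    rw [hG2]
    linear_combination (α + 1) * Real.Gamma α * f2
  have hA' := hA (m + 1) hm
  rw [← hx, ← hb] at hA'
  have hB' : Real.Gamma α * b * (α - c) ≤ Real.Gamma α * C₃ * P := by
    have h1 := hB (m + 1)
    rw [← hx, ← hb] at h1
    have h3 : (x + 1) ^ (α - 1) ≤ P :=
      Real.rpow_le_rpow_of_nonpos hx0 (by linarith) (by linarith)
    have h4 : b ≤ C₃ * P := h1.trans (by gcongr)
    have h5 : α - c ≤ 1 := by linarith
    calc Real.Gamma α * b * (α - c) ≤ Real.Gamma α * b * 1 := by gcongr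
      _ ≤ _ := by rw [mul_one, mul_assoc]; gcongr
  have hB'' : 0 ≤ Real.Gamma α * b * (α - c) := by
    have : 0 ≤ α - c := by linarith
    positivity
  set g := Real.Gamma α * b * (x + c)
  set g' := Real.Gamma α * b * (α - c)
  have hpow2 : x ^ (α - 2) * x = P := by
    rw [hP, ← Real.rpow_add_one hx0.ne']; congr 1; ring
  have hpow2' : x ^ (α - 2) ≤ P := Real.rpow_le_rpow_of_exponent_le hx1 (by linarith)
  have hpow1 : x ^ (1 + α) = x ^ α * x := by
    rw [← Real.rpow_add_one hx0.ne', add_comm]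
  have hpw := abs_add_rpow_sub_le hα₀ hα₁ hx1 hθ₀ hθ₁
  rw [← hP, hpow1] at hpw
  -- assemble
  have hmain : |Real.Gamma (2 + α) * (binomCoeff (α + 1 + 1) m - α / 2 * binomCoeff (α + 1) m
      + θ * binomCoeff (α + 1) (m + 1)) - (x + θ) ^ (1 + α)| ≤
      (3 * K + 2 * Real.Gamma α * C₃ + 1) * P := by
    have e : Real.Gamma (2 + α) * (binomCoeff (α + 1 + 1) m - α / 2 * binomCoeff (α + 1) m
      + θ * binomCoeff (α + 1) (m + 1)) - (x + θ) ^ (1 + α) =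
        (g - x ^ α) * x + θ * (α + 1) * (g - x ^ α) + θ * (α + 1) * g'
        - ((x + θ) ^ (1 + α) - (x ^ α * x + (1 + α) * θ * x ^ α)) := by
      linear_combination f4 + θ * f5
    have t1 : |(g - x ^ α) * x| ≤ K * P := by
      rw [abs_mul, abs_of_pos hx0, ← hpow2, ← mul_assoc]
      gcongr
    have ht : 0 ≤ θ * (α + 1) := by positivity
    have ht2 : θ * (α + 1) ≤ 2 := by
      calc θ * (α + 1) ≤ 1 * (1 + 1) := by gcongr
        _ = 2 := by norm_num
    have t2 : |θ * (α + 1) * (g - x ^ α)| ≤ 2 * (K * P) := by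
      rw [abs_mul, abs_of_nonneg ht]
      exact mul_le_mul ht2 (hA'.trans (by gcongr)) (abs_nonneg _) (by norm_num)
    have t3 : |θ * (α + 1) * g'| ≤ 2 * (Real.Gamma α * C₃ * P) := by
      rw [abs_of_nonneg (by positivity)]
      exact mul_le_mul ht2 hB' hB'' (by norm_num)
    rw [e]
    have t1' := abs_le.1 t1
    have t2' := abs_le.1 t2
    have t3' := abs_le.1 t3
    have t4' := abs_le.1 hpw
    exact abs_le.2 ⟨by linarith [t1'.1, t2'.1, t3'.1, t4'.2],
      by linarith [t1'.2, t2'.2, t3'.2, t4'.1]⟩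
  have hmain' : |(binomCoeff (α + 1 + 1) m - α / 2 * binomCoeff (α + 1) m
      + θ * binomCoeff (α + 1) (m + 1)) - (x + θ) ^ (1 + α) / Real.Gamma (2 + α)| ≤
      (3 * K + 2 * Real.Gamma α * C₃ + 1) / Real.Gamma (2 + α) * P := by
    set Q := binomCoeff (α + 1 + 1) m - α / 2 * binomCoeff (α + 1) m
      + θ * binomCoeff (α + 1) (m + 1)
    have e : Q - (x + θ) ^ (1 + α) / Real.Gamma (2 + α) =
        (Real.Gamma (2 + α) * Q - (x + θ) ^ (1 + α)) / Real.Gamma (2 + α) := by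
      rw [sub_div, mul_div_cancel_left₀ _ hG2p.ne']
    rw [e, abs_div, abs_of_pos hG2p, div_mul_eq_mul_div]
    gcongr
  have hθY : |θ * (Y - binomCoeff (α + 1) (m + 1))| ≤ C₂ * C₁ * P := by
    rw [abs_mul, abs_of_nonneg hθ₀]
    calc _ ≤ 1 * (C₂ * C₁ * P) := by gcongr
      _ = _ := one_mul _
  have hPθ : P ≤ 2 * (x + θ) ^ (α - 1) := by
    refine (Real.rpow_le_rpow_of_nonpos (by positivity) (?_ : (x + θ) / 2 ≤ x)
      (by linarith)).trans (rpow_div_le (by linarith) (by positivity) one_le_two)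
    linarith
  have u1 := abs_le.1 hV
  have u2 := abs_le.1 hθY
  have u3 := abs_le.1 hmain'
  calc _ ≤ (2 * (C₂ * C₁) + (3 * K + 2 * Real.Gamma α * C₃ + 1) / Real.Gamma (2 + α)) * P :=
        abs_le.2 ⟨by linarith [u1.1, u2.1, u3.1], by linarith [u1.2, u2.2, u3.2]⟩
    _ ≤ (2 * (C₂ * C₁) + (3 * K + 2 * Real.Gamma α * C₃ + 1) / Real.Gamma (2 + α)) *
        (2 * (x + θ) ^ (α - 1)) := by gcongr
    _ = _ := by ring

/-! ### Positivity of the convolution quadrature. -/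

lemma integral_exp_int_mul_I (k : ℤ) :
    ∫ t in (0 : ℝ)..2 * Real.pi, Complex.exp (k * t * Complex.I) =
      if k = 0 then (2 * Real.pi : ℂ) else 0 := by
  split_ifs with h
  · simp [h]
  · have hk : (k : ℂ) * Complex.I ≠ 0 := mul_ne_zero (by exact_mod_cast h) Complex.I_ne_zero
    have := integral_exp_mul_complex (a := 0) (b := 2 * Real.pi) hk
    simp_rw [show ∀ t : ℝ, (k : ℂ) * t * Complex.I = k * Complex.I * t from fun t => by ring]
    rw [this, show (k : ℂ) * Complex.I * ((2 * Real.pi : ℝ) : ℂ) = k * (2 * Real.pi * Complex.I) by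
      push_cast; ring, Complex.exp_int_mul_two_pi_mul_I]
    simp

/-- The Toeplitz matrix of the quadrature weights, damped by powers of `r`. -/
def cqToeplitz (α r : ℝ) (n p : ℕ) : ℝ := if p ≤ n then cqWeight α (n - p) * r ^ (n - p) else 0

lemma norm_ofReal_mul_exp_lt {r : ℝ} (hr₀ : 0 ≤ r) (hr₁ : r < 1) (t : ℝ) :
    ‖(r : ℂ) * Complex.exp (t * Complex.I)‖ < 1 := by
  rw [norm_mul, Complex.norm_exp_ofReal_mul_I, mul_one, Complex.norm_real, Real.norm_eq_abs,
    abs_of_nonneg hr₀]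
  exact hr₁

/-- Termwise integration of the Taylor series on the circle of radius r; r < 1 gives an integrable
dominating series and keeps away from the singularity at z = 1. -/
lemma symbol_fourier {α r : ℝ} (hα₀ : 0 < α) (hr₀ : 0 ≤ r) (hr₁ : r < 1) (n p : ℕ) :
    ∫ t in (0 : ℝ)..2 * Real.pi, symbol α (r * Complex.exp (t * Complex.I)) *
        Complex.exp (((p : ℤ) - (n : ℤ) : ℤ) * t * Complex.I) =
      2 * Real.pi * cqToeplitz α r n p := by
  set F : ℕ → ℝ → ℂ := fun m t => (cqWeight α m : ℂ) * (r * Complex.exp (t * Complex.I)) ^ m *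
        Complex.exp (((p : ℤ) - (n : ℤ) : ℤ) * t * Complex.I) with hF
  have hnorm (m : ℕ) (t : ℝ) : ‖F m t‖ = cqWeight α m * r ^ m := by
    rw [hF]
    simp only
    rw [norm_mul, norm_mul, norm_pow, norm_mul, Complex.norm_exp_ofReal_mul_I,
      show (((p : ℤ) - (n : ℤ) : ℤ) : ℂ) * t * Complex.I =
        (((((p : ℤ) - (n : ℤ) : ℤ) : ℝ) * t : ℝ) : ℂ) * Complex.I by push_cast; ring,
      Complex.norm_exp_ofReal_mul_I, Complex.norm_real, Complex.norm_real, Real.norm_eq_abs,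
      Real.norm_eq_abs, abs_of_nonneg hr₀, abs_of_pos (cqWeight_pos hα₀ m), mul_one, mul_one]
  have hsum : Summable fun m => cqWeight α m * r ^ m := by
    have := (hasSum_cqWeight α (z := r) (by
      rw [Complex.norm_real, Real.norm_eq_abs, abs_of_nonneg hr₀]; exact hr₁)).summable
    exact_mod_cast this
  have h1 : HasSum (fun m => ∫ t in (0 : ℝ)..2 * Real.pi, F m t)
      (∫ t in (0 : ℝ)..2 * Real.pi, symbol α (r * Complex.exp (t * Complex.I)) *
        Complex.exp (((p : ℤ) - (n : ℤ) : ℤ) * t * Complex.I)) := by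
    refine intervalIntegral.hasSum_integral_of_dominated_convergence
      (fun m _ => cqWeight α m * r ^ m) (fun m => ?_) ?_ ?_ ?_ ?_
    · exact Continuous.aestronglyMeasurable (by rw [hF]; fun_prop)
    · exact fun m => ae_of_all _ fun t _ => (hnorm m t).le
    · exact ae_of_all _ fun t _ => hsum
    · exact intervalIntegrable_const
    · exact ae_of_all _ fun t _ =>
        (hasSum_cqWeight α (norm_ofReal_mul_exp_lt hr₀ hr₁ t)).mul_right _
  have h2 (m : ℕ) : ∫ t in (0 : ℝ)..2 * Real.pi, F m t =
      (cqWeight α m : ℂ) * r ^ m * if (m : ℤ) + p - n = 0 then (2 * Real.pi : ℂ) else 0 := by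
    rw [← integral_exp_int_mul_I, ← intervalIntegral.integral_const_mul]
    refine intervalIntegral.integral_congr fun t _ => ?_
    simp only [hF]
    have : Complex.exp (m * (t * Complex.I)) *
        Complex.exp (((p : ℤ) - (n : ℤ) : ℤ) * t * Complex.I) =
        Complex.exp (((m : ℤ) + (p : ℤ) - (n : ℤ) : ℤ) * t * Complex.I) := by
      rw [← Complex.exp_add]
      congr 1
      push_cast
      ring
    rw [← this, mul_pow, ← Complex.exp_nat_mul]
    ring
  refine h1.unique ?_
  simp_rw [h2]
  rw [cqToeplitz]
  split_ifs with hpn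
  · have := hasSum_ite_eq (n - p) ((cqWeight α (n - p) : ℂ) * r ^ (n - p) * (2 * Real.pi))
    convert! this using 1
    · ext m
      by_cases hm : m = n - p
      · rw [if_pos hm, if_pos (by omega), hm]
      · rw [if_neg hm, if_neg (by omega), mul_zero]
    · push_cast; ring
  · have : ∀ m : ℕ, ¬ ((m : ℤ) + p - n = 0) := fun m => by omega
    simp [this]

lemma continuous_symbol {α r : ℝ} (hr₀ : 0 ≤ r) (hr₁ : r < 1) :
    Continuous fun t : ℝ => symbol α (r * Complex.exp (t * Complex.I)) := by
  refine continuous_iff_continuousAt.2 fun t => ?_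
  have h := symbolBase_re_pos (norm_ofReal_mul_exp_lt hr₀ hr₁ t)
  unfold symbol
  refine ContinuousAt.mul continuousAt_const (ContinuousAt.cpow (by fun_prop) continuousAt_const ?_)
  exact Or.inl h

/-- Positivity of the convolution quadrature for real sequences. -/
lemma cqToeplitz_nonneg {α r : ℝ} (hα₀ : 0 < α) (hα₁ : α < 1) (hr₀ : 0 ≤ r) (hr₁ : r < 1)
    (N : ℕ) (x : ℕ → ℝ) :
    0 ≤ ∑ n ∈ Finset.range N, ∑ p ∈ Finset.range N, cqToeplitz α r n p * (x n * x p) := by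
  set S := ∑ n ∈ Finset.range N, ∑ p ∈ Finset.range N, cqToeplitz α r n p * (x n * x p) with hS
  set Y : ℝ → ℂ := fun t => ∑ p ∈ Finset.range N, (x p : ℂ) * Complex.exp (p * t * Complex.I)
    with hY
  set f : ℝ → ℂ := fun t => symbol α (r * Complex.exp (t * Complex.I)) with hf
  have hcf : Continuous f := continuous_symbol hr₀ hr₁
  have hexp (t : ℝ) : f t * (Y t * (starRingEnd ℂ) (Y t)) =
      ∑ n ∈ Finset.range N, ∑ p ∈ Finset.range N, ((x n * x p : ℝ) : ℂ) *
        (f t * Complex.exp (((p : ℤ) - (n : ℤ) : ℤ) * t * Complex.I)) := by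
    rw [hY]
    simp only
    rw [map_sum, mul_comm (∑ p ∈ Finset.range N, _), Finset.sum_mul_sum, Finset.mul_sum]
    refine Finset.sum_congr rfl fun n _ => ?_
    rw [Finset.mul_sum]
    refine Finset.sum_congr rfl fun p _ => ?_
    rw [map_mul, Complex.conj_ofReal, ← Complex.exp_conj]
    have : Complex.exp ((starRingEnd ℂ) ((n : ℂ) * t * Complex.I)) *
        Complex.exp ((p : ℂ) * t * Complex.I) =
        Complex.exp (((p : ℤ) - (n : ℤ) : ℤ) * t * Complex.I) := by
      rw [← Complex.exp_add]
      congr 1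
      simp
      ring
    rw [← this]
    push_cast
    ring
  -- The Toeplitz form is the mean of the symbol against |Y|^2, Y being the trigonometric polynomial
  -- with coefficients x. Since the form is real, only the real part of the symbol counts.
  have hI : ∫ t in (0 : ℝ)..2 * Real.pi, f t * (Y t * (starRingEnd ℂ) (Y t)) =
      ((2 * Real.pi * S : ℝ) : ℂ) := by
    simp_rw [hexp]
    rw [intervalIntegral.integral_finsetSum fun n _ =>
      Continuous.intervalIntegrable (by fun_prop) _ _]
    rw [hS]
    push_cast
    rw [Finset.mul_sum]
    refine Finset.sum_congr rfl fun n _ => ?_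
    rw [intervalIntegral.integral_finsetSum fun n _ =>
      Continuous.intervalIntegrable (by fun_prop) _ _, Finset.mul_sum]
    refine Finset.sum_congr rfl fun p _ => ?_
    have h : ∫ t in (0 : ℝ)..2 * Real.pi, f t *
        Complex.exp (((p : ℤ) - (n : ℤ) : ℤ) * t * Complex.I) = _ :=
      symbol_fourier hα₀ hr₀ hr₁ n p
    push_cast at h
    rw [intervalIntegral.integral_const_mul, h]
    ring
  have hre : 2 * Real.pi * S = ∫ t in (0 : ℝ)..2 * Real.pi,
      (f t * (Y t * (starRingEnd ℂ) (Y t))).re := by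
    have hcY : Continuous Y := by rw [hY]; fun_prop
    have h : ∫ t in (0 : ℝ)..2 * Real.pi, (f t * (Y t * (starRingEnd ℂ) (Y t))).re =
        (∫ t in (0 : ℝ)..2 * Real.pi, f t * (Y t * (starRingEnd ℂ) (Y t))).re :=
      Complex.reCLM.intervalIntegral_comp_comm ((hcf.mul (hcY.mul (Complex.continuous_conj.comp hcY))).intervalIntegrable (μ := volume) 0
        (2 * Real.pi))
    rw [hI, Complex.ofReal_re] at h
    exact h.symm
  have hpos : 0 ≤ 2 * Real.pi * S := by
    rw [hre]
    refine intervalIntegral.integral_nonneg (by positivity) fun t _ => ?_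
    rw [Complex.mul_conj, Complex.re_mul_ofReal]
    exact mul_nonneg (re_symbol_nonneg hα₀ hα₁ (norm_ofReal_mul_exp_lt hr₀ hr₁ t))
      (Complex.normSq_nonneg _)
  exact nonneg_of_mul_nonneg_right hpos (by positivity)

/-- Form of the Schur product theorem for a not necessarily symmetric first factor. -/
lemma sum_mul_nonneg_of_psd {a G : ℕ → ℕ → ℝ} {N : ℕ}
    (ha : ∀ x : ℕ → ℝ, 0 ≤ ∑ n ∈ Finset.range N, ∑ p ∈ Finset.range N, a n p * (x n * x p))
    (hsymm : ∀ n p, G n p = G p n)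
    (hG : ∀ x : ℕ → ℝ, 0 ≤ ∑ n ∈ Finset.range N, ∑ p ∈ Finset.range N, G n p * (x n * x p)) :
    0 ≤ ∑ n ∈ Finset.range N, ∑ p ∈ Finset.range N, a n p * G n p := by
  have key (b : ℕ → ℕ → ℝ) (hb : ∀ n p, b n p = b p n)
      (h : ∀ x : ℕ → ℝ, 0 ≤ ∑ n ∈ Finset.range N, ∑ p ∈ Finset.range N, b n p * (x n * x p)) :
      (Matrix.of fun i j : Fin N => b i j).PosSemidef := by
    refine Matrix.PosSemidef.of_dotProduct_mulVec_nonneg (Matrix.IsHermitian.ext fun i j => ?_)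
      fun x => ?_
    · simp [hb i j]
    · have := h fun n => if hn : n < N then x ⟨n, hn⟩ else 0
      simp_rw [Finset.sum_range] at this
      simp only [Fin.is_lt, dite_true, Fin.eta] at this
      refine this.trans_eq ?_
      simp only [dotProduct, Matrix.mulVec, Matrix.of_apply, Finset.mul_sum, star_trivial]
      refine Finset.sum_congr rfl fun i _ => Finset.sum_congr rfl fun j _ => by ring
  have hswap (x : ℕ → ℕ → ℝ) (hx : ∀ n p, x n p = x p n) :
      ∑ n ∈ Finset.range N, ∑ p ∈ Finset.range N, a p n * x n p =
        ∑ n ∈ Finset.range N, ∑ p ∈ Finset.range N, a n p * x n p := by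
    rw [Finset.sum_comm]
    refine Finset.sum_congr rfl fun n _ => Finset.sum_congr rfl fun p _ => by rw [hx]
  -- The Schur product theorem needs a symmetric matrix, so a is symmetrised; as G is symmetric,
  -- both halves contribute equally. The product form is evaluated at the all-ones vector.
  have h1 := key (fun n p => a n p + a p n) (fun n p => add_comm _ _) fun x => by
    simp_rw [add_mul, Finset.sum_add_distrib]
    rw [hswap (fun n p => x n * x p) fun n p => mul_comm _ _]
    exact add_nonneg (ha x) (ha x)
  have h2 := (h1.hadamard (key G hsymm hG)).dotProduct_mulVec_nonneg (fun _ => 1)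
  have h3 : 0 ≤ ∑ n ∈ Finset.range N, ∑ p ∈ Finset.range N, (a n p + a p n) * G n p := by
    simp_rw [Finset.sum_range]
    simpa [dotProduct, Matrix.mulVec] using h2
  simp_rw [add_mul, Finset.sum_add_distrib] at h3
  rw [hswap G hsymm] at h3
  linarith

/-- Positivity of the convolution quadrature with respect to a positive semidefinite form,
with exponential weights. -/
lemma cq_form_nonneg {α r : ℝ} (hα₀ : 0 < α) (hα₁ : α < 1) (hr₀ : 0 ≤ r) (hr₁ : r < 1)
    {G : ℕ → ℕ → ℝ} {N : ℕ} (hsymm : ∀ n p, G n p = G p n)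
    (hG : ∀ x : ℕ → ℝ, 0 ≤ ∑ n ∈ Finset.range N, ∑ p ∈ Finset.range N, G n p * (x n * x p)) :
    0 ≤ ∑ n ∈ Finset.range N, r ^ (2 * n) *
      ∑ p ∈ Finset.range (n + 1), cqWeight α (n - p) * G n p := by
  -- The weight is split as r^(2n) = r^(n-p) · r^n r^p: the first factor damps the Toeplitz matrix,
  -- the second is a congruence of G.
  have h := sum_mul_nonneg_of_psd (G := fun n p => r ^ n * r ^ p * G n p)
    (cqToeplitz_nonneg hα₀ hα₁ hr₀ hr₁ N) (fun n p => by rw [hsymm n p]; ring) fun x => by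
      refine (hG fun n => r ^ n * x n).trans_eq ?_
      refine Finset.sum_congr rfl fun i _ => Finset.sum_congr rfl fun j _ => by ring
  refine h.trans_eq (Finset.sum_congr rfl fun n hn => ?_)
  rw [Finset.mul_sum]
  symm
  refine Finset.sum_subset_zero_on_sdiff
    (Finset.range_mono (Nat.succ_le_of_lt (Finset.mem_range.1 hn))) (fun p hp => ?_) fun p hp => ?_
  · rw [Finset.mem_sdiff, Finset.mem_range, Finset.mem_range] at hp
    rw [cqToeplitz, if_neg (by omega), zero_mul]
  · have hpn : p ≤ n := Nat.lt_succ_iff.1 (Finset.mem_range.1 hp)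
    rw [cqToeplitz, if_pos hpn]
    have : r ^ (2 * n) = r ^ (n - p) * (r ^ n * r ^ p) := by
      rw [← pow_add, ← pow_add]; congr 1; omega
    rw [this]
    ring

/-! ### Truncation error of the difference quotients, for real functions. -/

section Scalar
variable {g g₁ g₂ g₃ : ℝ → ℝ}

lemma hasDerivAt_of_hasDerivWithinAt_Ici (h₁ : ∀ t ≥ 0, HasDerivWithinAt g (g₁ t) (Ici 0) t)
    {t : ℝ} (ht : 0 < t) : HasDerivAt g (g₁ t) t :=
  (h₁ t ht.le).hasDerivAt (Ici_mem_nhds ht)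

/-- Measurability comes for free, since g₁ coincides with `deriv g` on the interval. -/
lemma intervalIntegrable_of_lintegral_enorm_lt_top {a b : ℝ} (hab : a ≤ b) (ha : 0 ≤ a)
    (h : ∀ t > 0, HasDerivAt g (g₁ t) t) (hfin : ∫⁻ s in Ioo a b, ‖g₁ s‖ₑ < ⊤) :
    IntervalIntegrable g₁ volume a b := by
  rw [intervalIntegrable_iff_integrableOn_Ioo_of_le hab]
  refine ⟨((measurable_deriv g).aestronglyMeasurable.congr ?_), hfin⟩
  filter_upwards [ae_restrict_mem measurableSet_Ioo] with t ht
  exact (h t (ha.trans_lt ht.1)).deriv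

lemma enorm_integral_le_lintegral_Ioo {a b : ℝ} (hab : a ≤ b) (f : ℝ → ℝ) :
    ‖∫ s in a..b, f s‖ₑ ≤ ∫⁻ s in Ioo a b, ‖f s‖ₑ := by
  rw [intervalIntegral.integral_of_le hab, integral_Ioc_eq_integral_Ioo]
  exact enorm_integral_le_lintegral_enorm _

/-- Integrability of g₂ gives g₁ a limit at 0+, and a limit of the derivative must equal the
one-sided derivative g₁ 0. Taylor formulas may thus start at 0 although g₂ is only the derivative on
t > 0. -/
lemma continuousOn_deriv_of_integrable {T : ℝ} (hT : 0 < T)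
    (h₁ : ∀ t ≥ 0, HasDerivWithinAt g (g₁ t) (Ici 0) t) (h₂ : ∀ t > 0, HasDerivAt g₁ (g₂ t) t)
    (hint : IntervalIntegrable g₂ volume 0 T) : ContinuousOn g₁ (Icc 0 T) := by
  have hprim : ContinuousOn (fun t => ∫ s in T..t, g₂ s) (uIcc 0 T) :=
    intervalIntegral.continuousOn_primitive_interval' hint right_mem_uIcc
  rw [uIcc_of_le hT.le] at hprim
  have heq : ∀ t ∈ Ioc 0 T, g₁ t = g₁ T + ∫ s in T..t, g₂ s := by
    intro t ht
    have hpos : ∀ x ∈ uIcc T t, 0 < x := fun x hx => by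
      rw [uIcc_of_ge ht.2] at hx
      exact ht.1.trans_le hx.1
    rw [intervalIntegral.integral_eq_sub_of_hasDerivAt (fun x hx => h₂ x (hpos x hx))
      (hint.symm.mono_set ?_)]
    · ring
    · rw [uIcc_of_ge ht.2, uIcc_of_ge hT.le]
      exact Icc_subset_Icc_left ht.1.le
  set L := g₁ T + ∫ s in T..(0 : ℝ), g₂ s with hL
  have hlim : Tendsto g₁ (𝓝[>] 0) (𝓝 L) := by
    have h : Tendsto (fun t => g₁ T + ∫ s in T..t, g₂ s) (𝓝[Icc 0 T] 0) (𝓝 L) :=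
      (hprim 0 (left_mem_Icc.2 hT.le)).tendsto.const_add _
    have h' : Tendsto (fun t => g₁ T + ∫ s in T..t, g₂ s) (𝓝[>] 0) (𝓝 L) := by
      rw [← nhdsWithin_Ioc_eq_nhdsGT hT]
      exact h.mono_left (nhdsWithin_mono _ Ioc_subset_Icc_self)
    refine h'.congr' ?_
    filter_upwards [Ioc_mem_nhdsGT hT] with t ht using (heq t ht).symm
  have hL0 : g₁ 0 = L := by
    have hd : HasDerivWithinAt g L (Ici 0) 0 := by
      refine hasDerivWithinAt_Ici_of_tendsto_deriv (s := Ioi 0) (fun t ht =>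
        (hasDerivAt_of_hasDerivWithinAt_Ici h₁ ht).differentiableAt.differentiableWithinAt)
        ((h₁ 0 le_rfl).continuousWithinAt.mono Ioi_subset_Ici_self) self_mem_nhdsWithin ?_
      refine hlim.congr' ?_
      filter_upwards [self_mem_nhdsWithin] with t ht
      exact (hasDerivAt_of_hasDerivWithinAt_Ici h₁ ht).deriv.symm
    exact (uniqueDiffOn_Ici 0 0 (by simp)).eq_deriv _ (h₁ 0 le_rfl) hd
  refine (hprim.const_add (g₁ T)).congr fun t ht => ?_
  rcases ht.1.eq_or_lt with rfl | h
  · rw [hL0]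
  · exact heq t ⟨h, ht.2⟩

lemma integral_affine_mul_second_deriv {a b : ℝ} (hab : a ≤ b) (c : ℝ)
    (hg : ContinuousOn g (Icc a b)) (hg₁ : ContinuousOn g₁ (Icc a b))
    (h₁ : ∀ t ∈ Ioo a b, HasDerivAt g (g₁ t) t) (h₂ : ∀ t ∈ Ioo a b, HasDerivAt g₁ (g₂ t) t)
    (hint : IntervalIntegrable g₂ volume a b) :
    ∫ s in a..b, (c - s) * g₂ s = (g b + (c - b) * g₁ b) - (g a + (c - a) * g₁ a) := by
  refine intervalIntegral.integral_eq_sub_of_hasDerivAt_of_le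
    (f := fun s => g s + (c - s) * g₁ s) hab (by fun_prop) (fun t ht => ?_)
    (hint.continuousOn_mul (by fun_prop))
  refine ((h₁ t ht).add (((hasDerivAt_id t).const_sub c).mul (h₂ t ht))).congr_deriv ?_
  simp

lemma integral_sq_mul_third_deriv {a b : ℝ} (hab : a ≤ b) (c : ℝ)
    (h₁ : ∀ t ∈ Icc a b, HasDerivAt g (g₁ t) t) (h₂ : ∀ t ∈ Icc a b, HasDerivAt g₁ (g₂ t) t)
    (h₃ : ∀ t ∈ Icc a b, HasDerivAt g₂ (g₃ t) t) (hint : IntervalIntegrable g₃ volume a b) :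
    ∫ s in a..b, (s - c) ^ 2 / 2 * g₃ s =
      (g b - (b - c) * g₁ b + (b - c) ^ 2 / 2 * g₂ b)
        - (g a - (a - c) * g₁ a + (a - c) ^ 2 / 2 * g₂ a) := by
  refine intervalIntegral.integral_eq_sub_of_hasDerivAt
    (f := fun s => g s - (s - c) * g₁ s + (s - c) ^ 2 / 2 * g₂ s) (fun t ht => ?_)
    (hint.continuousOn_mul (by fun_prop))
  rw [uIcc_of_le hab] at ht
  have hc := (hasDerivAt_id t).sub_const c
  refine (((h₁ t ht).sub (hc.mul (h₂ t ht))).add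
    (((hc.pow 2).div_const 2).mul (h₃ t ht))).congr_deriv ?_
  simp

lemma abs_integral_mul_le {f φ : ℝ → ℝ} {a b M : ℝ} (hab : a ≤ b)
    (hint : IntervalIntegrable f volume a b) (hφ : ∀ s ∈ Icc a b, |φ s| ≤ M) :
    |∫ s in a..b, φ s * f s| ≤ M * ∫ s in a..b, |f s| := by
  rw [← intervalIntegral.integral_const_mul, ← Real.norm_eq_abs]
  refine intervalIntegral.norm_integral_le_of_norm_le hab (ae_of_all _ fun s hs => ?_)
    (hint.abs.const_mul M)
  rw [Real.norm_eq_abs, abs_mul]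
  exact mul_le_mul_of_nonneg_right (hφ s (Ioc_subset_Icc_self hs)) (abs_nonneg _)

lemma ofReal_integral_abs {f : ℝ → ℝ} {a b : ℝ} (hab : a ≤ b)
    (hint : IntervalIntegrable f volume a b) :
    ENNReal.ofReal (∫ s in a..b, |f s|) = ∫⁻ s in Ioo a b, ‖f s‖ₑ := by
  rw [intervalIntegral.integral_of_le hab, integral_Ioc_eq_integral_Ioo]
  rw [intervalIntegrable_iff_integrableOn_Ioo_of_le hab] at hint
  exact ofReal_integral_norm_eq_lintegral_enorm hint

lemma enorm_le_of_abs_le {x M I : ℝ} {L : ℝ≥0∞} (hM : 0 ≤ M) (h : |x| ≤ M * I)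
    (hI : ENNReal.ofReal I = L) : ‖x‖ₑ ≤ ENNReal.ofReal M * L := by
  rw [← ofReal_norm, Real.norm_eq_abs, ← hI, ← ENNReal.ofReal_mul hM]
  exact ENNReal.ofReal_le_ofReal h

lemma integral_abs_mono {f : ℝ → ℝ} {a b c d : ℝ} (hca : c ≤ a) (hab : a ≤ b) (hbd : b ≤ d)
    (hint : IntervalIntegrable f volume c d) : ∫ s in a..b, |f s| ≤ ∫ s in c..d, |f s| :=
  intervalIntegral.integral_mono_interval hca hab hbd (ae_of_all _ fun _ => abs_nonneg _) hint.abs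

/-- Truncation error of the backward Euler step. -/
lemma enorm_backward_difference_le {k : ℝ} (hk : 0 < k)
    (h₁ : ∀ t ≥ 0, HasDerivWithinAt g (g₁ t) (Ici 0) t) (h₂ : ∀ t > 0, HasDerivAt g₁ (g₂ t) t) :
    ‖g₁ k - k⁻¹ * (g k - g 0)‖ₑ ≤ ENNReal.ofReal 3 * ∫⁻ s in Ioo 0 (2 * k), ‖g₂ s‖ₑ := by
  -- If the right-hand side is infinite there is nothing to prove; otherwise g₂ is integrable.
  by_cases hfin : ∫⁻ s in Ioo 0 (2 * k), ‖g₂ s‖ₑ = ⊤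
  · simp [hfin]
  have h2k : 0 < 2 * k := by linarith
  have hint := intervalIntegrable_of_lintegral_enorm_lt_top h2k.le le_rfl h₂ (lt_top_iff_ne_top.2 hfin)
  have hint' : IntervalIntegrable g₂ volume 0 k := hint.mono_set (by
    rw [uIcc_of_le hk.le, uIcc_of_le h2k.le]; exact Icc_subset_Icc_right (by linarith))
  have hc := continuousOn_deriv_of_integrable hk h₁ h₂ hint'
  have hg : ContinuousOn g (Icc 0 k) := fun t ht =>
    ((h₁ t ht.1).continuousWithinAt).mono Icc_subset_Ici_self
  have hJ := integral_affine_mul_second_deriv hk.le 0 hg hc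
    (fun t ht => hasDerivAt_of_hasDerivWithinAt_Ici h₁ ht.1) (fun t ht => h₂ t ht.1) hint'
  have hJb := abs_integral_mul_le (φ := fun s => 0 - s) (M := k) hk.le hint' fun s hs => by
    rw [zero_sub, abs_neg, abs_of_nonneg hs.1]; exact hs.2
  have hI := integral_abs_mono le_rfl hk.le (by linarith : k ≤ 2 * k) hint
  have hI0 : 0 ≤ ∫ s in (0 : ℝ)..k, |g₂ s| :=
    intervalIntegral.integral_nonneg hk.le fun _ _ => abs_nonneg _
  refine enorm_le_of_abs_le (by norm_num) ?_ (ofReal_integral_abs h2k.le hint)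
  have e : g₁ k - k⁻¹ * (g k - g 0) = -(k⁻¹ * ∫ s in (0 : ℝ)..k, (0 - s) * g₂ s) := by
    rw [hJ]; field_simp; ring
  rw [e, abs_neg, abs_mul, abs_of_pos (inv_pos.2 hk), inv_mul_le_iff₀ hk]
  nlinarith

/-- Truncation error of the BDF2 difference quotient at the second time level. -/
lemma enorm_bdf2_difference_two_le {k : ℝ} (hk : 0 < k)
    (h₁ : ∀ t ≥ 0, HasDerivWithinAt g (g₁ t) (Ici 0) t) (h₂ : ∀ t > 0, HasDerivAt g₁ (g₂ t) t) :
    ‖g₁ (2 * k) - (3 / 2 * (k⁻¹ * (g (2 * k) - g k)) - 1 / 2 * (k⁻¹ * (g k - g 0)))‖ₑ ≤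
      ENNReal.ofReal 3 * ∫⁻ s in Ioo 0 (2 * k), ‖g₂ s‖ₑ := by
  by_cases hfin : ∫⁻ s in Ioo 0 (2 * k), ‖g₂ s‖ₑ = ⊤
  · simp [hfin]
  have h2k : 0 < 2 * k := by linarith
  have hint := intervalIntegrable_of_lintegral_enorm_lt_top h2k.le le_rfl h₂ (lt_top_iff_ne_top.2 hfin)
  have hint' : IntervalIntegrable g₂ volume k (2 * k) := hint.mono_set (by
    rw [uIcc_of_le (by linarith), uIcc_of_le h2k.le]; exact Icc_subset_Icc_left (by linarith))
  have hc := continuousOn_deriv_of_integrable h2k h₁ h₂ hint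
  have hg : ContinuousOn g (Icc 0 (2 * k)) := fun t ht =>
    ((h₁ t ht.1).continuousWithinAt).mono Icc_subset_Ici_self
  have hsub : Icc k (2 * k) ⊆ Icc 0 (2 * k) := Icc_subset_Icc_left hk.le
  have hJ₂ := integral_affine_mul_second_deriv h2k.le 0 hg hc
    (fun t ht => hasDerivAt_of_hasDerivWithinAt_Ici h₁ ht.1) (fun t ht => h₂ t ht.1) hint
  have hJ₁ := integral_affine_mul_second_deriv (by linarith) k (hg.mono hsub) (hc.mono hsub)
    (fun t ht => hasDerivAt_of_hasDerivWithinAt_Ici h₁ (hk.trans ht.1))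
    (fun t ht => h₂ t (hk.trans ht.1)) hint'
  have hb₂ := abs_integral_mul_le (φ := fun s => 0 - s) (M := 2 * k) h2k.le hint fun s hs => by
    rw [zero_sub, abs_neg, abs_of_nonneg hs.1]; exact hs.2
  have hb₁ := abs_integral_mul_le (φ := fun s => k - s) (M := k) (by linarith) hint' fun s hs => by
    rw [abs_sub_comm, abs_of_nonneg (by linarith [hs.1])]; linarith [hs.2]
  have hI := integral_abs_mono hk.le (by linarith : k ≤ 2 * k) le_rfl hint
  refine enorm_le_of_abs_le (by norm_num) ?_ (ofReal_integral_abs h2k.le hint)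
  set J₁ := ∫ s in k..2 * k, (k - s) * g₂ s
  set J₂ := ∫ s in (0 : ℝ)..2 * k, (0 - s) * g₂ s
  set I := ∫ s in (0 : ℝ)..2 * k, |g₂ s|
  -- The combination 2 J₁ - J₂/2 reproduces the BDF2 coefficients 3/2, -2, 1/2. From |J₁| ≤ k I and
  -- |J₂| ≤ 2k I comes the constant 3.
  have e : g₁ (2 * k) - (3 / 2 * (k⁻¹ * (g (2 * k) - g k)) - 1 / 2 * (k⁻¹ * (g k - g 0))) =
      -(k⁻¹ * (2 * J₁ - J₂ / 2)) := by
    rw [hJ₁, hJ₂]; field_simp; ring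
  rw [e, abs_neg, abs_mul, abs_of_pos (inv_pos.2 hk), inv_mul_le_iff₀ hk]
  have q₁ := abs_le.1 (hb₁.trans (mul_le_mul_of_nonneg_left hI hk.le))
  have q₂ := abs_le.1 hb₂
  exact abs_le.2 ⟨by linarith [q₁.1, q₂.2], by linarith [q₁.2, q₂.1]⟩

/-- Truncation error of the BDF2 difference quotient away from the initial time. -/
lemma enorm_bdf2_difference_le {k t : ℝ} (hk : 0 < k) (ht : 0 < t - 2 * k)
    (h₁ : ∀ t > 0, HasDerivAt g (g₁ t) t) (h₂ : ∀ t > 0, HasDerivAt g₁ (g₂ t) t)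
    (h₃ : ∀ t > 0, HasDerivAt g₂ (g₃ t) t) :
    ‖g₁ t - (3 / 2 * (k⁻¹ * (g t - g (t - k))) - 1 / 2 * (k⁻¹ * (g (t - k) - g (t - 2 * k))))‖ₑ ≤
      ENNReal.ofReal (2 * k) * ((∫⁻ s in Ioo (t - 2 * k) (t - k), ‖g₃ s‖ₑ) +
        ∫⁻ s in Ioo (t - k) t, ‖g₃ s‖ₑ) := by
  by_cases hfin₁ : ∫⁻ s in Ioo (t - 2 * k) (t - k), ‖g₃ s‖ₑ = ⊤
  · simp [hfin₁, hk]
  by_cases hfin₂ : ∫⁻ s in Ioo (t - k) t, ‖g₃ s‖ₑ = ⊤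
  · simp [hfin₂, hk]
  have hab : t - 2 * k ≤ t - k := by linarith
  have hbt : t - k ≤ t := by linarith
  have hi₁ := intervalIntegrable_of_lintegral_enorm_lt_top hab ht.le h₃
    (lt_top_iff_ne_top.2 hfin₁)
  have hi₂ := intervalIntegrable_of_lintegral_enorm_lt_top hbt (by linarith) h₃
    (lt_top_iff_ne_top.2 hfin₂)
  have hi := hi₁.trans hi₂
  have hJ₁ := integral_sq_mul_third_deriv hbt (t - k) (fun s hs => h₁ s (by linarith [hs.1]))
    (fun s hs => h₂ s (by linarith [hs.1])) (fun s hs => h₃ s (by linarith [hs.1])) hi₂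
  have hJ₂ := integral_sq_mul_third_deriv (hab.trans hbt) (t - 2 * k)
    (fun s hs => h₁ s (by linarith [hs.1])) (fun s hs => h₂ s (by linarith [hs.1]))
    (fun s hs => h₃ s (by linarith [hs.1])) hi
  have hb₁ := abs_integral_mul_le (φ := fun s => (s - (t - k)) ^ 2 / 2) (M := k ^ 2 / 2) hbt hi₂
    fun s hs => by
      rw [abs_of_nonneg (by positivity)]
      have := pow_le_pow_left₀ (by linarith [hs.1] : 0 ≤ s - (t - k)) (by linarith [hs.2]) 2
        (b := k)
      linarith
  have hb₂ := abs_integral_mul_le (φ := fun s => (s - (t - 2 * k)) ^ 2 / 2) (M := 2 * k ^ 2)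
    (hab.trans hbt) hi fun s hs => by
      rw [abs_of_nonneg (by positivity)]
      have := pow_le_pow_left₀ (by linarith [hs.1] : 0 ≤ s - (t - 2 * k)) (by linarith [hs.2]) 2
        (b := 2 * k)
      linarith
  have hI := integral_abs_mono hab hbt le_rfl hi
  have hL : ENNReal.ofReal (∫ s in (t - 2 * k)..t, |g₃ s|) =
      (∫⁻ s in Ioo (t - 2 * k) (t - k), ‖g₃ s‖ₑ) + ∫⁻ s in Ioo (t - k) t, ‖g₃ s‖ₑ := by
    rw [← ofReal_integral_abs hab hi₁, ← ofReal_integral_abs hbt hi₂, ← ENNReal.ofReal_add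
      (intervalIntegral.integral_nonneg hab fun _ _ => abs_nonneg _)
      (intervalIntegral.integral_nonneg hbt fun _ _ => abs_nonneg _),
      intervalIntegral.integral_add_adjacent_intervals hi₁.abs hi₂.abs]
  refine enorm_le_of_abs_le (by positivity) ?_ hL
  set J₁ := ∫ s in (t - k)..t, (s - (t - k)) ^ 2 / 2 * g₃ s
  set J₂ := ∫ s in (t - 2 * k)..t, (s - (t - 2 * k)) ^ 2 / 2 * g₃ s
  set I := ∫ s in (t - 2 * k)..t, |g₃ s|
  -- Same combination as at the second level; now the g₂ terms k^2 and -k^2 cancel, which is second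
  -- order consistency. From |J₁| ≤ k^2 I/2 and |J₂| ≤ 2k^2 I comes the factor 2k.
  have e : g₁ t - (3 / 2 * (k⁻¹ * (g t - g (t - k))) -
      1 / 2 * (k⁻¹ * (g (t - k) - g (t - 2 * k)))) = -(k⁻¹ * (2 * J₁ - J₂ / 2)) := by
    rw [hJ₁, hJ₂]; field_simp; ring
  rw [e, abs_neg, abs_mul, abs_of_pos (inv_pos.2 hk), inv_mul_le_iff₀ hk]
  have q₁ := abs_le.1 (hb₁.trans (mul_le_mul_of_nonneg_left hI (by positivity)))
  have q₂ := abs_le.1 hb₂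
  exact abs_le.2 ⟨by linarith [q₁.1, q₂.2], by linarith [q₁.2, q₂.1]⟩

end Scalar

/-! ### Peano kernel of the quadrature error. -/

section Quadrature
variable {g g₁ g₂ : ℝ → ℝ} {α : ℝ}

lemma intervalIntegrable_abelKernel (hα₀ : 0 < α) (T : ℝ) :
    IntervalIntegrable (fun ζ => abelKernel α (T - ζ)) volume 0 T := by
  have h := (intervalIntegral.intervalIntegrable_rpow' (a := 0) (b := T)
    (by linarith : -1 < α - 1)).div_const (Real.Gamma α)
  have h' := h.comp_sub_left T
  simp only [sub_zero, sub_self] at h'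
  exact h'.symm

lemma hasDerivAt_sub_rpow_div {p T s : ℝ} (hs : s < T) :
    HasDerivAt (fun s => (T - s) ^ (p + 1)) (-((p + 1) * (T - s) ^ p)) s := by
  have h := ((hasDerivAt_id s).const_sub T).rpow_const (p := p + 1)
    (Or.inl (sub_pos.2 hs).ne')
  refine h.congr_deriv ?_
  simp
  ring

/-- Two integrations by parts, done with one primitive. It is continuous up to T and vanishes there,
because the powers α and 1 + α are positive. -/
lemma conv_abelKernel_eq (hα₀ : 0 < α) {T : ℝ} (hT : 0 ≤ T)
    (hg : ContinuousOn g (Icc 0 T)) (hg₁ : ContinuousOn g₁ (Icc 0 T))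
    (h₁ : ∀ t ∈ Ioo 0 T, HasDerivAt g (g₁ t) t) (h₂ : ∀ t ∈ Ioo 0 T, HasDerivAt g₁ (g₂ t) t)
    (hint : IntervalIntegrable g₂ volume 0 T) :
    conv (abelKernel α) g T = T ^ α / Real.Gamma (1 + α) * g 0
      + T ^ (1 + α) / Real.Gamma (2 + α) * g₁ 0
      + ∫ s in (0 : ℝ)..T, (T - s) ^ (1 + α) / Real.Gamma (2 + α) * g₂ s := by
  have hG1 : Real.Gamma (1 + α) = α * Real.Gamma α := by
    rw [add_comm, Real.Gamma_add_one hα₀.ne']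
  have hG2 : Real.Gamma (2 + α) = (1 + α) * Real.Gamma (1 + α) := by
    rw [show 2 + α = (1 + α) + 1 by ring, Real.Gamma_add_one (by linarith)]
  have hGp := Real.Gamma_pos_of_pos hα₀
  have hG1p := Real.Gamma_pos_of_pos (by linarith : 0 < 1 + α)
  have c₁ : Continuous fun s : ℝ => (T - s) ^ α :=
    (continuous_const.sub continuous_id).rpow_const fun s => Or.inr hα₀.le
  have c₂ : Continuous fun s : ℝ => (T - s) ^ (1 + α) :=
    (continuous_const.sub continuous_id).rpow_const fun s => Or.inr (by linarith)
  have hi₁ : IntervalIntegrable (fun s => abelKernel α (T - s) * g s) volume 0 T :=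
    (intervalIntegrable_abelKernel hα₀ T).mul_continuousOn (by rwa [uIcc_of_le hT])
  have hi₂ : IntervalIntegrable (fun s => (T - s) ^ (1 + α) / Real.Gamma (2 + α) * g₂ s)
      volume 0 T := hint.continuousOn_mul (c₂.div_const _).continuousOn
  have h := intervalIntegral.integral_eq_sub_of_hasDerivAt_of_le
    (f := fun s => (T - s) ^ α / Real.Gamma (1 + α) * g s
      + (T - s) ^ (1 + α) / Real.Gamma (2 + α) * g₁ s)
    (f' := fun s => (T - s) ^ (1 + α) / Real.Gamma (2 + α) * g₂ s - abelKernel α (T - s) * g s)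
    hT (((c₁.div_const _).continuousOn.mul hg).add ((c₂.div_const _).continuousOn.mul hg₁))
    (fun t ht => ?_) (hi₂.sub hi₁)
  · rw [intervalIntegral.integral_sub hi₂ hi₁] at h
    simp only [sub_self, sub_zero, Real.zero_rpow hα₀.ne',
      Real.zero_rpow (by linarith : (1 + α) ≠ 0), zero_div, zero_mul, add_zero, zero_sub] at h
    simp only [conv, smul_eq_mul]
    linarith
  · have d₁ := hasDerivAt_sub_rpow_div (p := α - 1) ht.2
    have d₂ := hasDerivAt_sub_rpow_div (p := α) ht.2
    rw [sub_add_cancel] at d₁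
    rw [add_comm α 1] at d₂
    refine (((d₁.div_const (Real.Gamma (1 + α))).mul (h₁ t ht)).add
      ((d₂.div_const (Real.Gamma (2 + α))).mul (h₂ t ht))).congr_deriv ?_
    rw [abelKernel, hG2, hG1]
    have : (1 + α) ≠ 0 := by linarith
    field_simp
    ring

lemma conv_abelKernel_one (hα₀ : 0 < α) {T : ℝ} (hT : 0 ≤ T) :
    conv (abelKernel α) (fun _ => (1 : ℝ)) T = T ^ α / Real.Gamma (1 + α) := by
  have := conv_abelKernel_eq (g := fun _ => 1) (g₁ := fun _ => 0) (g₂ := fun _ => 0) hα₀ hT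
    continuousOn_const continuousOn_const (fun t _ => hasDerivAt_const t 1)
    (fun t _ => hasDerivAt_const t 0) intervalIntegrable_const
  simpa using this

/-- Peano kernel of the quadrature error at the time level `n`. -/
def peanoKernel (α k : ℝ) (n : ℕ) (s : ℝ) : ℝ :=
  (n * k - s) ^ (1 + α) / Real.Gamma (2 + α)
    - k ^ α * ∑ p ∈ Finset.Icc 1 n, cqWeight α (n - p) * max (p * k - s) 0

lemma integral_max_sub_mul {t T : ℝ} (h0 : 0 ≤ t) (htT : t ≤ T)
    (hint : IntervalIntegrable g₂ volume 0 T) :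
    ∫ s in (0 : ℝ)..T, max (t - s) 0 * g₂ s = ∫ s in (0 : ℝ)..t, (t - s) * g₂ s := by
  have hi : IntervalIntegrable (fun s => max (t - s) 0 * g₂ s) volume 0 T :=
    hint.continuousOn_mul (by fun_prop)
  have s₁ : uIcc 0 t ⊆ uIcc 0 T := by
    rw [uIcc_of_le h0, uIcc_of_le (h0.trans htT)]; exact Icc_subset_Icc_right htT
  have s₂ : uIcc t T ⊆ uIcc 0 T := by
    rw [uIcc_of_le htT, uIcc_of_le (h0.trans htT)]; exact Icc_subset_Icc_left h0
  rw [← intervalIntegral.integral_add_adjacent_intervals (hi.mono_set s₁) (hi.mono_set s₂)]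
  have e₁ : ∫ s in (0 : ℝ)..t, max (t - s) 0 * g₂ s = ∫ s in (0 : ℝ)..t, (t - s) * g₂ s :=
    intervalIntegral.integral_congr fun s hs => by
      rw [uIcc_of_le h0] at hs
      rw [max_eq_left (by linarith [hs.2])]
  have e₂ : ∫ s in t..T, max (t - s) 0 * g₂ s = ∫ s in t..T, (0 : ℝ) :=
    intervalIntegral.integral_congr fun s hs => by
      rw [uIcc_of_le htT] at hs
      rw [max_eq_right (by linarith [hs.1]), zero_mul]
  rw [e₁, e₂]
  simp

/-- Peano representation of the quadrature error. -/
lemma conv_sub_cqRule_eq (hα₀ : 0 < α) {k : ℝ} (hk : 0 < k) (n : ℕ)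
    (hg : ContinuousOn g (Icc 0 (n * k))) (hg₁ : ContinuousOn g₁ (Icc 0 (n * k)))
    (h₁ : ∀ t ∈ Ioo 0 (n * k), HasDerivAt g (g₁ t) t)
    (h₂ : ∀ t ∈ Ioo 0 (n * k), HasDerivAt g₁ (g₂ t) t)
    (hint : IntervalIntegrable g₂ volume 0 (n * k)) :
    conv (abelKernel α) g (n * k) - cqRule α k (fun p => g (p * k)) n =
      peanoKernel α k n 0 * g₁ 0 + ∫ s in (0 : ℝ)..n * k, peanoKernel α k n s * g₂ s := by
  have hT : 0 ≤ n * k := by positivity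
  have c₂ : Continuous fun s : ℝ => (n * k - s) ^ (1 + α) :=
    (continuous_const.sub continuous_id).rpow_const fun s => Or.inr (by linarith)
  -- Taylor expansion at 0 with the remainder written through a truncated power, so that all nodes
  -- share the interval of integration [0, nk]. The constant g 0 drops out later thanks to the
  -- starting weight.
  have hnode : ∀ p ∈ Finset.Icc 1 n, g (p * k) =
      g 0 + p * k * g₁ 0 + ∫ s in (0 : ℝ)..n * k, max (p * k - s) 0 * g₂ s := by
    intro p hp
    have hpn : p * k ≤ n * k := by
      gcongr; exact_mod_cast (Finset.mem_Icc.1 hp).2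
    have hp0 : 0 ≤ p * k := by positivity
    rw [integral_max_sub_mul hp0 hpn hint, integral_affine_mul_second_deriv hp0 _
      (hg.mono (Icc_subset_Icc_right hpn)) (hg₁.mono (Icc_subset_Icc_right hpn))
      (fun t ht => h₁ t ⟨ht.1, ht.2.trans_le hpn⟩) (fun t ht => h₂ t ⟨ht.1, ht.2.trans_le hpn⟩)
      (hint.mono_set (by rw [uIcc_of_le hp0, uIcc_of_le hT]; exact Icc_subset_Icc_right hpn))]
    ring
  have hsum : ∫ s in (0 : ℝ)..n * k, peanoKernel α k n s * g₂ s =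
      (∫ s in (0 : ℝ)..n * k, (n * k - s) ^ (1 + α) / Real.Gamma (2 + α) * g₂ s)
        - k ^ α * ∑ p ∈ Finset.Icc 1 n, cqWeight α (n - p) *
          ∫ s in (0 : ℝ)..n * k, max (p * k - s) 0 * g₂ s := by
    have hi (p : ℕ) : IntervalIntegrable (fun s => max (p * k - s) 0 * g₂ s) volume 0 (n * k) :=
      hint.continuousOn_mul (by fun_prop)
    simp_rw [← intervalIntegral.integral_const_mul]
    rw [← intervalIntegral.integral_finsetSum fun p _ => (hi p).const_mul _,
      ← intervalIntegral.integral_const_mul, ← intervalIntegral.integral_sub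
        (hint.continuousOn_mul (c₂.div_const _).continuousOn)]
    · refine intervalIntegral.integral_congr fun s _ => ?_
      simp only [peanoKernel]
      rw [sub_mul, mul_assoc, Finset.sum_mul]
      simp_rw [mul_assoc]
    · have := (IntervalIntegrable.sum (Finset.Icc 1 n)
        fun p _ => (hi p).const_mul (cqWeight α (n - p))).const_mul (k ^ α)
      simpa only [Finset.sum_apply] using this
  rw [conv_abelKernel_eq hα₀ hT hg hg₁ h₁ h₂ hint, hsum, cqRule, startWeight,
    conv_abelKernel_one hα₀ hT, peanoKernel]
  simp only [smul_eq_mul, Nat.cast_zero, zero_mul, sub_zero]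
  have hmax : ∀ p : ℕ, max ((p : ℝ) * k) 0 = p * k := fun p => max_eq_left (by positivity)
  have hS : ∑ p ∈ Finset.Icc 1 n, cqWeight α (n - p) * g (p * k) =
      (∑ p ∈ Finset.Icc 1 n, cqWeight α (n - p)) * g 0
        + (∑ p ∈ Finset.Icc 1 n, cqWeight α (n - p) * (p * k)) * g₁ 0
        + ∑ p ∈ Finset.Icc 1 n, cqWeight α (n - p) *
          ∫ s in (0 : ℝ)..n * k, max (p * k - s) 0 * g₂ s := by
    rw [Finset.sum_mul, Finset.sum_mul, ← Finset.sum_add_distrib, ← Finset.sum_add_distrib]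
    refine Finset.sum_congr rfl fun p hp => ?_
    rw [hnode p hp]
    ring
  rw [hS]
  simp only [hmax]
  ring

/-- Bounds for the Peano kernel of the quadrature error. -/
lemma exists_abs_peanoKernel_le (hα₀ : 0 < α) (hα₁ : α < 1) :
    ∃ C : ℝ, 0 < C ∧ ∀ (k : ℝ) (n : ℕ) (s : ℝ), 0 < k → 1 ≤ n → 0 ≤ s →
      (s ≤ ((n : ℝ) - 1) * k → |peanoKernel α k n s| ≤ C * (k ^ 2 * (n * k - s) ^ (α - 1))) ∧
      (((n : ℝ) - 1) * k < s → s ≤ n * k → |peanoKernel α k n s| ≤ C * k ^ (α + 1)) := by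
  obtain ⟨C, hC, hK⟩ := exists_abs_sum_cqWeight_sub_le hα₀ hα₁
  have hG2 := Real.Gamma_pos_of_pos (by linarith : 0 < 2 + α)
  have hw := cqWeight_pos hα₀ 0
  refine ⟨C + (cqWeight α 0 + 1 / Real.Gamma (2 + α)), by positivity, fun k n s hk hn hs => ?_⟩
  -- By scaling, with distance k(m + θ) from s to the level, the kernel is minus k^(α+1) times the
  -- unit-step error on a shifted linear function. The case m ≥ 1 is
  -- `exists_abs_sum_cqWeight_sub_le`; m = 0 is the last step, where a single weight remains.
  have key : ∀ (m : ℕ) (θ : ℝ), 0 ≤ θ → θ < 1 → n * k - s = k * (m + θ) →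
      peanoKernel α k n s = -(k ^ (α + 1) * (∑ l ∈ Finset.range (m + 1),
        cqWeight α l * ((m : ℝ) - l + θ) - ((m : ℝ) + θ) ^ (1 + α) / Real.Gamma (2 + α))) := by
    intro m θ hθ₀ hθ₁ h
    have hmn : m ≤ n := by
      have : (m : ℝ) ≤ n := by
        have h1 : k * (m + θ) ≤ k * n := by linarith
        have := le_of_mul_le_mul_left h1 hk
        linarith
      exact_mod_cast this
    have hsum : ∑ p ∈ Finset.Icc 1 n, cqWeight α (n - p) * max (p * k - s) 0 =
        k * ∑ l ∈ Finset.range (m + 1), cqWeight α l * ((m : ℝ) - l + θ) := by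
      have e₁ : ∑ p ∈ Finset.Icc 1 n, cqWeight α (n - p) * max (p * k - s) 0 =
          ∑ p ∈ Finset.range (n + 1), cqWeight α (n - p) * max (p * k - s) 0 := by
        refine Finset.sum_subset (fun p hp => ?_) fun p hp hp' => ?_
        · rw [Finset.mem_Icc] at hp; rw [Finset.mem_range]; omega
        · have : p = 0 := by
            rw [Finset.mem_range] at hp; rw [Finset.mem_Icc] at hp'; omega
          rw [this, Nat.cast_zero, zero_mul, max_eq_right (by linarith), mul_zero]
      rw [e₁, ← Finset.sum_range_reflect, Finset.mul_sum]
      symm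
      refine Finset.sum_subset_zero_on_sdiff (Finset.range_mono (by omega)) (fun l hl => ?_)
        fun l hl => ?_
      · rw [Finset.mem_sdiff, Finset.mem_range, Finset.mem_range] at hl
        have hl1 : (m : ℝ) + 1 ≤ l := by exact_mod_cast (by omega : m + 1 ≤ l)
        rw [max_eq_right, mul_zero]
        rw [show n + 1 - 1 - l = n - l by omega, Nat.cast_sub (by omega)]
        nlinarith
      · rw [Finset.mem_range] at hl
        have hl1 : (l : ℝ) ≤ m := by exact_mod_cast (by omega : l ≤ m)
        rw [show n + 1 - 1 - l = n - l by omega, Nat.cast_sub (by omega),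
          show n - (n - l) = l by omega]
        have e₂ : ((n : ℝ) - l) * k - s = k * (m - l + θ) := by linarith
        rw [e₂, max_eq_left (mul_nonneg hk.le (by linarith))]
        ring
    rw [peanoKernel, hsum, h, Real.mul_rpow hk.le (by positivity), Real.rpow_add_one hk.ne',
      add_comm 1 α, Real.rpow_add_one hk.ne']
    ring
  constructor
  · intro hsn
    have hx : 0 ≤ (n * k - s) / k := div_nonneg (by nlinarith) hk.le
    have hx1 : 1 ≤ (n * k - s) / k := by rw [le_div_iff₀ hk]; linarith
    have hm : 1 ≤ ⌊(n * k - s) / k⌋₊ := Nat.le_floor (by exact_mod_cast hx1)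
    have hfl := Nat.floor_le hx
    have hfl2 := Nat.lt_floor_add_one ((n * k - s) / k)
    set m := ⌊(n * k - s) / k⌋₊
    set θ := (n * k - s) / k - m with hθ
    have hsum : n * k - s = k * (m + θ) := by rw [hθ]; field_simp; ring
    have hθ₀ : 0 ≤ θ := by linarith
    have hθ₁ : θ < 1 := by linarith
    rw [key m θ hθ₀ hθ₁ hsum, abs_neg, abs_mul, abs_of_pos (by positivity), hsum,
      Real.mul_rpow hk.le (by positivity)]
    have e : k ^ (α + 1) = k ^ 2 * k ^ (α - 1) := by
      rw [← Real.rpow_natCast, ← Real.rpow_add hk]; congr 1; push_cast; ring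
    rw [e]
    have hmθ : 0 < (m : ℝ) + θ := by
      have : (1 : ℝ) ≤ m := by exact_mod_cast hm
      linarith
    calc _ ≤ k ^ 2 * k ^ (α - 1) * (C * ((m : ℝ) + θ) ^ (α - 1)) := by
          gcongr; exact hK m θ hm hθ₀ hθ₁.le
      _ = C * (k ^ 2 * (k ^ (α - 1) * ((m : ℝ) + θ) ^ (α - 1))) := by ring
      _ ≤ _ := by gcongr; exact le_add_of_nonneg_right (by positivity)
  · intro hsn hsn'
    set θ := (n * k - s) / k with hθ
    have hθ₀ : 0 ≤ θ := div_nonneg (by linarith) hk.le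
    have hθ₁ : θ < 1 := by rw [hθ, div_lt_one hk]; linarith
    have hsum : n * k - s = k * ((0 : ℕ) + θ) := by rw [hθ]; simp; field_simp
    rw [key 0 θ hθ₀ hθ₁ hsum, abs_neg, abs_mul, abs_of_pos (by positivity), mul_comm]
    have hp₀ : 0 ≤ θ ^ (1 + α) := by positivity
    have hp₁ : θ ^ (1 + α) ≤ 1 := Real.rpow_le_one hθ₀ hθ₁.le (by linarith)
    have hq : θ ^ (1 + α) / Real.Gamma (2 + α) ≤ 1 / Real.Gamma (2 + α) := by gcongr
    have hq₀ : 0 ≤ θ ^ (1 + α) / Real.Gamma (2 + α) := by positivity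
    have hwθ : cqWeight α 0 * θ ≤ cqWeight α 0 := mul_le_of_le_one_right hw.le hθ₁.le
    have hwθ₀ : 0 ≤ cqWeight α 0 * θ := by positivity
    gcongr
    simp only [zero_add, Finset.range_one, Finset.sum_singleton, Nat.cast_zero, sub_zero]
    exact abs_le.2 ⟨by linarith, by linarith⟩

end Quadrature

/-- On (0, a) the weight (T - s)^(α-1) is at least T^(α-1), so finiteness of the weighted integral
yields the plain integrability that the Peano formula requires. -/
lemma lintegral_enorm_le_of_weighted {α T a : ℝ} (hα₁ : α < 1) (haT : a < T) (ha : 0 ≤ a)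
    (f : ℝ → ℝ) :
    ∫⁻ s in Ioo 0 a, ‖f s‖ₑ ≤ ENNReal.ofReal (T ^ (1 - α)) *
      ∫⁻ s in Ioo 0 a, ENNReal.ofReal ((T - s) ^ (α - 1)) * ‖f s‖ₑ := by
  have hT : 0 < T := ha.trans_lt haT
  rw [← lintegral_const_mul' _ _ ENNReal.ofReal_ne_top]
  refine setLIntegral_mono_ae' measurableSet_Ioo (ae_of_all _ fun s hs => ?_)
  rw [← mul_assoc, ← ENNReal.ofReal_mul (by positivity)]
  refine le_mul_of_one_le_left zero_le ?_
  rw [ENNReal.one_le_ofReal]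
  have hTs : 0 < T - s := by linarith [hs.2]
  calc (1 : ℝ) = T ^ (1 - α) * T ^ (α - 1) := by rw [← Real.rpow_add hT]; simp
    _ ≤ T ^ (1 - α) * (T - s) ^ (α - 1) := by
      gcongr ?_ * ?_
      exact Real.rpow_le_rpow_of_nonpos hTs (by linarith [hs.1]) (by linarith)

/-- Error of the quadrature for real functions. -/
lemma exists_enorm_conv_sub_cqRule_le {α : ℝ} (hα₀ : 0 < α) (hα₁ : α < 1) :
    ∃ C : ℝ, 0 < C ∧ ∀ (k : ℝ) (n : ℕ) (g g₁ g₂ : ℝ → ℝ), 0 < k → 1 ≤ n →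
      (∀ t ≥ 0, HasDerivWithinAt g (g₁ t) (Ici 0) t) → (∀ t > 0, HasDerivAt g₁ (g₂ t) t) →
      ‖conv (abelKernel α) g (n * k) - cqRule α k (fun p => g (p * k)) n‖ₑ ≤
        ENNReal.ofReal C * (ENNReal.ofReal (k ^ 2 * (n * k) ^ (α - 1)) * ‖g₁ 0‖ₑ
          + ENNReal.ofReal (k ^ (α + 1)) * (∫⁻ s in Ioo (((n : ℝ) - 1) * k) (n * k), ‖g₂ s‖ₑ)
          + ENNReal.ofReal (k ^ 2) * (∫⁻ s in Ioo 0 (((n : ℝ) - 1) * k),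
              ENNReal.ofReal ((n * k - s) ^ (α - 1)) * ‖g₂ s‖ₑ)) := by
  obtain ⟨C, hC, hK⟩ := exists_abs_peanoKernel_le hα₀ hα₁
  refine ⟨C, hC, fun k n g g₁ g₂ hk hn h₁ h₂ => ?_⟩
  have hn' : (1 : ℝ) ≤ n := by exact_mod_cast hn
  set T : ℝ := n * k with hT
  set a : ℝ := ((n : ℝ) - 1) * k with ha
  have ha0 : 0 ≤ a := mul_nonneg (by linarith) hk.le
  have haT : a < T := by rw [ha, hT]; nlinarith
  have hT0 : 0 < T := ha0.trans_lt haT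
  set X := ∫⁻ s in Ioo 0 a, ENNReal.ofReal ((T - s) ^ (α - 1)) * ‖g₂ s‖ₑ with hX
  set Y := ∫⁻ s in Ioo a T, ‖g₂ s‖ₑ with hY
  have hCne : ENNReal.ofReal C ≠ 0 := by simpa using hC
  have hk2 : ENNReal.ofReal (k ^ 2) ≠ 0 := by simp [hk.ne']
  have hk1 : ENNReal.ofReal (k ^ (α + 1)) ≠ 0 := by
    rw [Ne, ENNReal.ofReal_eq_zero, not_le]; positivity
  -- An infinite X or Y makes the bound trivial, their coefficients being nonzero.
  by_cases hXt : X = ⊤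
  · rw [hXt, ENNReal.mul_top hk2, add_top, ENNReal.mul_top hCne]
    exact le_top
  by_cases hYt : Y = ⊤
  · rw [hYt, ENNReal.mul_top hk1, add_top, top_add, ENNReal.mul_top hCne]
    exact le_top
  have hint : IntervalIntegrable g₂ volume 0 T := by
    refine (intervalIntegrable_of_lintegral_enorm_lt_top ha0 le_rfl h₂ ?_).trans
      (intervalIntegrable_of_lintegral_enorm_lt_top haT.le ha0 h₂ (lt_top_iff_ne_top.2 hYt))
    exact (lintegral_enorm_le_of_weighted hα₁ haT ha0 g₂).trans_lt
      (ENNReal.mul_lt_top ENNReal.ofReal_lt_top (lt_top_iff_ne_top.2 hXt))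
  have hg : ContinuousOn g (Icc 0 T) := fun t ht =>
    ((h₁ t ht.1).continuousWithinAt).mono Icc_subset_Ici_self
  rw [conv_sub_cqRule_eq hα₀ hk n hg (continuousOn_deriv_of_integrable hT0 h₁ h₂ hint)
    (fun t ht => hasDerivAt_of_hasDerivWithinAt_Ici h₁ ht.1) (fun t ht => h₂ t ht.1) hint, ← hT]
  have hZ : ‖peanoKernel α k n 0 * g₁ 0‖ₑ ≤
      ENNReal.ofReal C * (ENNReal.ofReal (k ^ 2 * T ^ (α - 1)) * ‖g₁ 0‖ₑ) := by
    rw [enorm_mul, ← mul_assoc, ← ENNReal.ofReal_mul hC.le]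
    gcongr
    have := (hK k n 0 hk hn le_rfl).1 ha0
    rw [sub_zero] at this
    rw [← ofReal_norm]
    exact ENNReal.ofReal_le_ofReal this
  have hXb : ∫⁻ s in Ioo 0 a, ‖peanoKernel α k n s * g₂ s‖ₑ ≤
      ENNReal.ofReal C * (ENNReal.ofReal (k ^ 2) * X) := by
    rw [← mul_assoc, hX, ← lintegral_const_mul' _ _
      (ENNReal.mul_ne_top ENNReal.ofReal_ne_top ENNReal.ofReal_ne_top)]
    refine setLIntegral_mono_ae' measurableSet_Ioo (ae_of_all _ fun s hs => ?_)
    rw [enorm_mul, ← mul_assoc, mul_assoc (ENNReal.ofReal C), ← ENNReal.ofReal_mul (by positivity),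
      ← ENNReal.ofReal_mul hC.le]
    gcongr
    rw [← ofReal_norm]
    exact ENNReal.ofReal_le_ofReal ((hK k n s hk hn hs.1.le).1 hs.2.le)
  have hYb : ∫⁻ s in Ioo a T, ‖peanoKernel α k n s * g₂ s‖ₑ ≤
      ENNReal.ofReal C * (ENNReal.ofReal (k ^ (α + 1)) * Y) := by
    rw [← mul_assoc, hY, ← lintegral_const_mul' _ _
      (ENNReal.mul_ne_top ENNReal.ofReal_ne_top ENNReal.ofReal_ne_top)]
    refine setLIntegral_mono_ae' measurableSet_Ioo (ae_of_all _ fun s hs => ?_)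
    rw [enorm_mul, ← ENNReal.ofReal_mul hC.le]
    gcongr
    rw [← ofReal_norm]
    exact ENNReal.ofReal_le_ofReal ((hK k n s hk hn (ha0.trans hs.1.le)).2 hs.1 hs.2.le)
  have hsplit : ∫⁻ s in Ioo 0 T, ‖peanoKernel α k n s * g₂ s‖ₑ ≤
      (∫⁻ s in Ioo 0 a, ‖peanoKernel α k n s * g₂ s‖ₑ) +
        ∫⁻ s in Ioo a T, ‖peanoKernel α k n s * g₂ s‖ₑ := by
    rw [setLIntegral_congr (Ioo_ae_eq_Ioc (a := (0 : ℝ)) (b := a))]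
    refine (lintegral_mono_set fun s hs => ?_).trans (lintegral_union_le _ _ _)
    rcases le_or_gt s a with h | h
    · exact Or.inl ⟨hs.1, h⟩
    · exact Or.inr ⟨h, hs.2⟩
  calc _ ≤ ‖peanoKernel α k n 0 * g₁ 0‖ₑ + ‖∫ s in (0 : ℝ)..T, peanoKernel α k n s * g₂ s‖ₑ :=
        enorm_add_le _ _
    _ ≤ ENNReal.ofReal C * (ENNReal.ofReal (k ^ 2 * T ^ (α - 1)) * ‖g₁ 0‖ₑ) +
        (ENNReal.ofReal C * (ENNReal.ofReal (k ^ 2) * X)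
          + ENNReal.ofReal C * (ENNReal.ofReal (k ^ (α + 1)) * Y)) := by
        gcongr
        exact (enorm_integral_le_lintegral_Ioo hT0.le _).trans
          (hsplit.trans (add_le_add hXb hYb))
    _ = _ := by ring

lemma IsSelfAdjointPosDef.inner_symm {𝕜 H : Type*} [RCLike 𝕜] [NormedAddCommGroup H]
    [InnerProductSpace 𝕜 H] [CompleteSpace H] {A : H →ₗ.[𝕜] H} (hA : IsSelfAdjointPosDef A) (x y : A.domain) :
    inner 𝕜 (A x) (y : H) = inner 𝕜 (x : H) (A y) := by
  have h := LinearPMap.adjoint_isFormalAdjoint hA.selfAdjoint.dense_domain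
  rw [LinearPMap.isSelfAdjoint_def.1 hA.selfAdjoint] at h
  exact h x y

/-! ### Duality: reduction to real functions. -/

section Pairing
variable {𝕜 H : Type*} [RCLike 𝕜] [NormedAddCommGroup H] [InnerProductSpace 𝕜 H]
  [NormedSpace ℝ H] [IsScalarTower ℝ 𝕜 H]

variable (𝕜) in
/-- The continuous real-linear functional `x ↦ re ⟪y, x⟫`. -/
def rePairing (y : H) : H →L[ℝ] ℝ :=
  RCLike.reCLM.comp ((innerSL 𝕜 y).restrictScalars ℝ)

lemma rePairing_apply (y x : H) : rePairing 𝕜 y x = RCLike.re (inner 𝕜 y x) := rfl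

lemma enorm_rePairing_le (y x : H) : ‖rePairing 𝕜 y x‖ₑ ≤ ‖x‖ₑ * ‖y‖ₑ := by
  rw [← ofReal_norm, ← ofReal_norm, ← ofReal_norm, ← ENNReal.ofReal_mul (norm_nonneg _)]
  refine ENNReal.ofReal_le_ofReal ?_
  rw [rePairing_apply, Real.norm_eq_abs, mul_comm]
  exact (RCLike.abs_re_le_norm _).trans (norm_inner_le_norm y x)

/-- For finite L the inequality is a closed condition on y, hence holds for all y, in particular for
y = x. Testing on the domain of A is therefore enough. -/
lemma enorm_le_of_rePairing_le {D : Set H} (hD : Dense D) (x : H) (L : ℝ≥0∞)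
    (h : ∀ y ∈ D, ‖rePairing 𝕜 y x‖ₑ ≤ L * ‖y‖ₑ) : ‖x‖ₑ ≤ L := by
  by_cases hL : L = ⊤
  · rw [hL]; exact le_top
  have h' : ∀ y ∈ D, |RCLike.re (inner 𝕜 y x)| ≤ L.toReal * ‖y‖ := fun y hy => by
    have := ENNReal.toReal_mono (ENNReal.mul_ne_top hL enorm_ne_top) (h y hy)
    rwa [ENNReal.toReal_mul, toReal_enorm, toReal_enorm, rePairing_apply,
      Real.norm_eq_abs] at this
  have hcl : IsClosed {y : H | |RCLike.re (inner 𝕜 y x)| ≤ L.toReal * ‖y‖} :=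
    isClosed_le (by fun_prop) (by fun_prop)
  have hx : |RCLike.re (inner 𝕜 x x)| ≤ L.toReal * ‖x‖ := hcl.closure_subset_iff.2 h' (hD x)
  rw [inner_self_eq_norm_sq, abs_of_nonneg (by positivity)] at hx
  have hx' : ‖x‖ ≤ L.toReal := by
    rcases (norm_nonneg x).eq_or_lt with h0 | h0
    · rw [← h0]; exact ENNReal.toReal_nonneg
    · nlinarith
  rw [← ofReal_norm]
  exact ENNReal.ofReal_le_of_le_toReal hx'

lemma map_cqRule (φ : H →L[ℝ] ℝ) (α k : ℝ) (v : ℕ → H) (n : ℕ) :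
    φ (cqRule α k v n) = cqRule α k (fun p => φ (v p)) n := by
  simp [cqRule]

variable [CompleteSpace H] {A : H →ₗ.[𝕜] H}

lemma IsSelfAdjointPosDef.rePairing_map (hA : IsSelfAdjointPosDef A) (x y : A.domain) :
    rePairing 𝕜 (y : H) (A x) = rePairing 𝕜 (A y) (x : H) := by
  rw [rePairing_apply, rePairing_apply, hA.inner_symm]

end Pairing

/-! ### Truncation error in the Hilbert space. -/

section Truncation
variable {𝕜 H : Type*} [RCLike 𝕜] [NormedAddCommGroup H] [InnerProductSpace 𝕜 H]
  [NormedSpace ℝ H] {A : H →ₗ.[𝕜] H} {u u₁ u₂ : ℝ → A.domain} {u₃ : ℝ → H}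

/-- The difference operator of the scheme: backward Euler at the first level, BDF2 afterwards. -/
def schemeDiff {E : Type*} [NormedAddCommGroup E] [NormedSpace ℝ E] (k : ℝ) (v : ℕ → E) (n : ℕ) :
    E :=
  if n = 1 then bdiff k v 1 else bdiff2 k v n

lemma map_bdiff {E : Type*} [NormedAddCommGroup E] [NormedSpace ℝ E] (φ : E →L[ℝ] ℝ) (k : ℝ)
    (v : ℕ → E) (n : ℕ) : φ (bdiff k v n) = bdiff k (fun p => φ (v p)) n := by
  simp [bdiff]

lemma map_schemeDiff {E : Type*} [NormedAddCommGroup E] [NormedSpace ℝ E] (φ : E →L[ℝ] ℝ) (k : ℝ)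
    (v : ℕ → E) (n : ℕ) : φ (schemeDiff k v n) = schemeDiff k (fun p => φ (v p)) n := by
  unfold schemeDiff
  split_ifs
  · exact map_bdiff φ k v 1
  · simp [bdiff2, map_bdiff]

lemma HasTimeDerivs.first_map (hu : HasTimeDerivs A u u₁ u₂ u₃) (φ : H →L[ℝ] ℝ) :
    ∀ t ≥ 0, HasDerivWithinAt (fun s => φ (u s)) (φ (u₁ t)) (Ici 0) t := fun t ht =>
  φ.hasFDerivAt.comp_hasDerivWithinAt t (hu.first t ht)

lemma HasTimeDerivs.second_map (hu : HasTimeDerivs A u u₁ u₂ u₃) (φ : H →L[ℝ] ℝ) :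
    ∀ t > 0, HasDerivAt (fun s => φ (u₁ s)) (φ (u₂ t)) t := fun t ht =>
  φ.hasFDerivAt.comp_hasDerivAt t (hu.second t ht)

lemma HasTimeDerivs.third_map (hu : HasTimeDerivs A u u₁ u₂ u₃) (φ : H →L[ℝ] ℝ) :
    ∀ t > 0, HasDerivAt (fun s => φ (u₂ s)) (φ (u₃ t)) t := fun t ht =>
  φ.hasFDerivAt.comp_hasDerivAt t (hu.third t ht)

/-- The truncation error of the scheme at the level `n`. -/
def truncError (A : H →ₗ.[𝕜] H) (α k : ℝ) (u u₁ : ℝ → A.domain) (n : ℕ) : H :=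
  ((u₁ (n * k) : H) - schemeDiff k (fun p : ℕ => (u (p * k) : H)) n)
    + (conv (abelKernel α) (fun ζ => A (u ζ)) (n * k)
      - cqRule α k (fun p : ℕ => A (u (p * k))) n)

variable [IsScalarTower ℝ 𝕜 H]

lemma lintegral_rePairing_le (y : H) (v : ℝ → H) (s : Set ℝ) :
    ∫⁻ t in s, ‖rePairing 𝕜 y (v t)‖ₑ ≤ (∫⁻ t in s, ‖v t‖ₑ) * ‖y‖ₑ := by
  rw [← lintegral_mul_const' _ _ enorm_ne_top]
  exact lintegral_mono fun t => enorm_rePairing_le y (v t)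

/-- At the first two levels the stencil reaches t = 0, near which only u₂ enters the bound; hence
the separate term over (0, 2k). -/
lemma enorm_rePairing_diff_le (hu : HasTimeDerivs A u u₁ u₂ u₃) {k : ℝ} (hk : 0 < k) (y : H)
    {n : ℕ} (hn : n = 1 ∨ n = 2) :
    ‖rePairing 𝕜 y ((u₁ (n * k) : H) - schemeDiff k (fun p : ℕ => (u (p * k) : H)) n)‖ₑ ≤
      ENNReal.ofReal 3 * (∫⁻ t in Ioo 0 (2 * k), ‖(u₂ t : H)‖ₑ) * ‖y‖ₑ := by
  rw [mul_assoc, map_sub, map_schemeDiff]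
  refine le_trans ?_ (mul_le_mul_right (lintegral_rePairing_le (𝕜 := 𝕜) y (fun t => (u₂ t : H)) _) _)
  rcases hn with rfl | rfl
  · have := enorm_backward_difference_le hk (hu.first_map (rePairing 𝕜 y))
      (hu.second_map (rePairing 𝕜 y))
    simpa [schemeDiff, bdiff] using this
  · have := enorm_bdf2_difference_two_le hk (hu.first_map (rePairing 𝕜 y))
      (hu.second_map (rePairing 𝕜 y))
    simpa [schemeDiff, bdiff2, bdiff] using this

lemma enorm_rePairing_diff_le_of_three_le (hu : HasTimeDerivs A u u₁ u₂ u₃) {k : ℝ} (hk : 0 < k)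
    (y : H) {n : ℕ} (hn : 3 ≤ n) :
    ‖rePairing 𝕜 y ((u₁ (n * k) : H) - schemeDiff k (fun p : ℕ => (u (p * k) : H)) n)‖ₑ ≤
      ENNReal.ofReal (2 * k) * ((∫⁻ t in Ioo (((n : ℝ) - 2) * k) (((n : ℝ) - 1) * k), ‖u₃ t‖ₑ) +
        ∫⁻ t in Ioo (((n : ℝ) - 1) * k) (n * k), ‖u₃ t‖ₑ) * ‖y‖ₑ := by
  rw [mul_assoc, map_sub, map_schemeDiff, add_mul]
  refine le_trans ?_ (mul_le_mul_right (add_le_add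
    (lintegral_rePairing_le (𝕜 := 𝕜) y u₃ _) (lintegral_rePairing_le (𝕜 := 𝕜) y u₃ _)) _)
  have hn' : (3 : ℝ) ≤ n := by exact_mod_cast hn
  have := enorm_bdf2_difference_le (t := n * k) hk (by nlinarith)
    (fun t ht => hasDerivAt_of_hasDerivWithinAt_Ici (hu.first_map (rePairing 𝕜 y)) ht)
    (hu.second_map (rePairing 𝕜 y)) (hu.third_map (rePairing 𝕜 y))
  have e₁ : (n : ℝ) * k - k = ((n : ℝ) - 1) * k := by ring
  have e₂ : (n : ℝ) * k - 2 * k = ((n : ℝ) - 2) * k := by ring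
  rw [e₁, e₂] at this
  have c₁ : ((n - 1 : ℕ) : ℝ) = (n : ℝ) - 1 := by rw [Nat.cast_sub (by omega)]; simp
  have c₂ : ((n - 1 - 1 : ℕ) : ℝ) = (n : ℝ) - 2 := by
    rw [show n - 1 - 1 = n - 2 by omega, Nat.cast_sub (by omega)]; simp
  rw [schemeDiff, if_neg (by omega), bdiff2, bdiff, bdiff, c₁, c₂]
  exact this

/-- Pairing of the quadrature error with an element of the domain. -/
lemma exists_enorm_rePairing_quadrature_le {α : ℝ} (hα₀ : 0 < α) (hα₁ : α < 1) :
    ∃ C : ℝ, 0 < C ∧ ∀ (𝕜 H : Type*) [RCLike 𝕜] [NormedAddCommGroup H] [InnerProductSpace 𝕜 H]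
      [NormedSpace ℝ H] [IsScalarTower ℝ 𝕜 H] [CompleteSpace H] (A : H →ₗ.[𝕜] H) (k : ℝ)
      (f : ℝ → H) (u₀ : H) (u u₁ u₂ : ℝ → A.domain) (u₃ : ℝ → H) (y : A.domain) (n : ℕ),
      IsSelfAdjointPosDef A → 0 < k → 1 ≤ n → IsSolution A (abelKernel α) f u₀ u →
      HasTimeDerivs A u u₁ u₂ u₃ →
      ‖rePairing 𝕜 (y : H) (conv (abelKernel α) (fun ζ => A (u ζ)) (n * k)
        - cqRule α k (fun p : ℕ => A (u (p * k))) n)‖ₑ ≤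
      ENNReal.ofReal C * (ENNReal.ofReal (k ^ 2 * (n * k) ^ (α - 1)) * ‖A (u₁ 0)‖ₑ
          + ENNReal.ofReal (k ^ (α + 1)) *
            (∫⁻ s in Ioo (((n : ℝ) - 1) * k) (n * k), ‖A (u₂ s)‖ₑ)
          + ENNReal.ofReal (k ^ 2) * (∫⁻ s in Ioo 0 (((n : ℝ) - 1) * k),
              ENNReal.ofReal ((n * k - s) ^ (α - 1)) * ‖A (u₂ s)‖ₑ)) * ‖(y : H)‖ₑ := by
  obtain ⟨C, hC, hE⟩ := exists_enorm_conv_sub_cqRule_le hα₀ hα₁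
  refine ⟨C, hC, ?_⟩
  intro 𝕜 H _ _ _ _ _ _ A k f u₀ u u₁ u₂ u₃ y n hA hk hn hsol hu
  have hnk : 0 < (n : ℝ) * k := by
    have : (1 : ℝ) ≤ n := by exact_mod_cast hn
    positivity
  -- A is moved onto y: the integrand becomes t ↦ ⟨A y, u(t)⟩, which inherits the derivatives of u.
  have hpair : ∀ x : A.domain, rePairing 𝕜 (y : H) (A x) = rePairing 𝕜 (A y) (x : H) :=
    fun x => hA.rePairing_map x y
  have hconv : rePairing 𝕜 (y : H) (conv (abelKernel α) (fun ζ => A (u ζ)) (n * k)) =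
      conv (abelKernel α) (fun ζ => rePairing 𝕜 (A y) (u ζ : H)) (n * k) := by
    have := (rePairing 𝕜 (y : H)).intervalIntegral_comp_comm (hsol.integrable (n * k) hnk)
    rw [conv, ← this, conv]
    refine intervalIntegral.integral_congr fun s _ => ?_
    rw [map_smul, hpair]
  have hcq : rePairing 𝕜 (y : H) (cqRule α k (fun p : ℕ => A (u (p * k))) n) =
      cqRule α k (fun p : ℕ => rePairing 𝕜 (A y) (u (p * k) : H)) n := by
    rw [map_cqRule]
    simp_rw [hpair]
  rw [map_sub, hconv, hcq]
  refine (hE k n _ _ _ hk hn (hu.first_map (rePairing 𝕜 (A y)))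
    (hu.second_map (rePairing 𝕜 (A y)))).trans ?_
  rw [mul_assoc, add_mul, add_mul, mul_assoc (ENNReal.ofReal _), mul_assoc (ENNReal.ofReal _),
    mul_assoc (ENNReal.ofReal _)]
  -- A is moved back, now onto u₁ 0 and u₂; this uses that they take values in the domain.
  simp_rw [← hpair]
  gcongr
  · exact enorm_rePairing_le _ _
  · exact lintegral_rePairing_le _ _ _
  · rw [← lintegral_mul_const' _ _ enorm_ne_top]
    refine lintegral_mono fun t => ?_
    rw [mul_assoc]
    gcongr
    exact enorm_rePairing_le _ _

end Truncation

/-! ### Energy stability in the exponentially weighted norm. -/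

section Stability
variable {𝕜 H : Type*} [RCLike 𝕜] [NormedAddCommGroup H] [InnerProductSpace 𝕜 H]
  [NormedSpace ℝ H] [IsScalarTower ℝ 𝕜 H]

lemma rePairing_self (x : H) : rePairing 𝕜 x x = ‖x‖ ^ 2 := by
  rw [rePairing_apply, inner_self_eq_norm_sq]

lemma rePairing_comm (x y : H) : rePairing 𝕜 x y = rePairing 𝕜 y x := by
  rw [rePairing_apply, rePairing_apply, inner_re_symm]

lemma rePairing_le (x y : H) : rePairing 𝕜 x y ≤ ‖x‖ * ‖y‖ := by
  rw [rePairing_apply]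
  exact re_inner_le_norm x y

/-- `G`-stability of the BDF2 method. -/
lemma bdf2_gStability (a b c : H) :
    (‖a‖ ^ 2 + ‖a + a - b‖ ^ 2 - (‖b‖ ^ 2 + ‖b + b - c‖ ^ 2)) / 4 ≤
      3 / 2 * rePairing 𝕜 a a - 2 * rePairing 𝕜 a b + 1 / 2 * rePairing 𝕜 a c := by
  -- The two sides of the claim differ by exactly ‖a - 2b + c‖^2 / 4.
  have h := sq_nonneg ‖a - b - b + c‖
  rw [← rePairing_self (𝕜 := 𝕜)] at h
  simp only [← rePairing_self (𝕜 := 𝕜)]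
  simp only [rePairing_apply, inner_add_left, inner_sub_left, map_add, map_sub] at h ⊢
  rw [inner_re_symm (𝕜 := 𝕜) b a, inner_re_symm (𝕜 := 𝕜) c a, inner_re_symm (𝕜 := 𝕜) c b] at *
  linarith

/-- The energy of the BDF2 method. -/
def bdfEnergy (e : ℕ → H) (n : ℕ) : ℝ := ‖e n‖ ^ 2 + ‖e n + e n - e (n - 1)‖ ^ 2

/-- For n ≥ 1 this is G-stability. The Euler step produces only ‖e 1‖^2, whereas a quarter of the
energy is 5‖e 1‖^2 / 4; the correction term is this deficit. -/
lemma bdfEnergy_sub_le {e : ℕ → H} (h0 : e 0 = 0) {k : ℝ} (hk : 0 < k) (n : ℕ) :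
    (bdfEnergy e (n + 1) - bdfEnergy e n) / 4 - (if n = 0 then ‖e 1‖ ^ 2 / 4 else 0) ≤
      k * rePairing 𝕜 (e (n + 1)) (schemeDiff k e (n + 1)) := by
  rw [map_schemeDiff, schemeDiff]
  rcases n with _ | n
  · have h2 : ‖e 1 + e 1‖ ^ 2 = 4 * ‖e 1‖ ^ 2 := by
      rw [← rePairing_self (𝕜 := 𝕜), ← rePairing_self (𝕜 := 𝕜)]
      simp only [rePairing_apply, inner_add_left, map_add]
      ring
    simp only [bdfEnergy, zero_add, if_true, bdiff, h0, smul_eq_mul, map_zero, sub_zero,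
      Nat.sub_self, Nat.zero_sub, norm_zero, add_zero, rePairing_self, h2]
    field_simp
    norm_num
    linarith
  · have h := bdf2_gStability (𝕜 := 𝕜) (e (n + 1 + 1)) (e (n + 1)) (e n)
    rw [if_neg (by omega), if_neg (by omega), sub_zero]
    simp only [bdfEnergy, bdiff2, bdiff, smul_eq_mul, Nat.add_sub_cancel]
    refine h.trans_eq ?_
    field_simp
    ring

/-- Abel summation. The factor 1 - ρ, available because the weights decay, is what turns control of
increments into control of the weighted sum, uniformly in N. -/
lemma sum_weighted_sub_eq (E : ℕ → ℝ) (ρ : ℝ) (N : ℕ) :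
    ∑ i ∈ Finset.range N, ρ ^ (i + 1) * (E (i + 1) - E i) =
      (1 - ρ) * ∑ i ∈ Finset.range N, ρ ^ (i + 1) * E (i + 1) + ρ ^ (N + 1) * E N - ρ * E 0 := by
  induction N with
  | zero => simp
  | succ N ih =>
    rw [Finset.sum_range_succ, Finset.sum_range_succ, ih]
    ring

variable [CompleteSpace H] {A : H →ₗ.[𝕜] H}

lemma IsSelfAdjointPosDef.re_inner_nonneg (hA : IsSelfAdjointPosDef A) (x : A.domain) :
    0 ≤ rePairing 𝕜 (x : H) (A x) := by
  rw [rePairing_comm, rePairing_apply]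
  by_cases hx : x = 0
  · simp [hx]
  · exact (hA.pos x hx).le

/-- The double sum is ⟨w, A w⟩ for w = ∑ x_n e_n. -/
lemma IsSelfAdjointPosDef.gram_nonneg (hA : IsSelfAdjointPosDef A) (e : ℕ → A.domain) (N : ℕ)
    (x : ℕ → ℝ) :
    0 ≤ ∑ n ∈ Finset.range N, ∑ p ∈ Finset.range N,
      rePairing 𝕜 (e n : H) (A (e p)) * (x n * x p) := by
  have h := hA.re_inner_nonneg (∑ n ∈ Finset.range N, (x n : 𝕜) • e n)
  refine h.trans_eq ?_
  rw [show A (∑ n ∈ Finset.range N, (x n : 𝕜) • e n) =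
    ∑ n ∈ Finset.range N, A ((x n : 𝕜) • e n) from map_sum A.toFun _ _, rePairing_apply]
  push_cast
  rw [sum_inner, map_sum]
  refine Finset.sum_congr rfl fun n _ => ?_
  rw [inner_sum, map_sum]
  refine Finset.sum_congr rfl fun p _ => ?_
  rw [LinearPMap.map_smul, inner_smul_left, inner_smul_right, RCLike.conj_ofReal,
    RCLike.re_ofReal_mul, RCLike.re_ofReal_mul, rePairing_apply]
  ring

/-- Stability of the scheme in the exponentially weighted norm. -/
lemma scheme_stability (hA : IsSelfAdjointPosDef A) {α k r : ℝ} (hα₀ : 0 < α) (hα₁ : α < 1)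
    (hk : 0 < k) (hr₀ : 0 < r) (hr₁ : r < 1) (e : ℕ → A.domain) (he : (e 0 : H) = 0) (τ : ℕ → H)
    (heq : ∀ n ≥ 1, schemeDiff k (fun p => (e p : H)) n + A (e n)
      + k ^ α • ∑ p ∈ Finset.Icc 1 n, cqWeight α (n - p) • A (e p) = τ n) (N : ℕ) :
    ∑ i ∈ Finset.range N, r ^ (2 * (i + 1)) * ‖(e (i + 1) : H)‖ ^ 2 ≤
      (5 / (1 - r ^ 2) * k * ∑ i ∈ Finset.range N, r ^ (i + 1) * ‖τ (i + 1)‖) ^ 2 := by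
  set v : ℕ → H := fun p => (e p : H) with hv
  set G : ℕ → ℕ → ℝ := fun n p => rePairing 𝕜 (v n) (A (e p)) with hG
  set q : ℕ → ℝ := fun n => ∑ p ∈ Finset.Icc 1 n, cqWeight α (n - p) * G n p with hq
  have hρ : 0 < 1 - r ^ 2 := by nlinarith
  have hGn : ∀ n, 0 ≤ G n n := fun n => hA.re_inner_nonneg (e n)
  have hkα : 0 < k ^ α := by positivity
  have htest : ∀ n ≥ 1, rePairing 𝕜 (v n) (schemeDiff k v n) + G n n + k ^ α * q n ≤
      ‖v n‖ * ‖τ n‖ := by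
    intro n hn
    have h := rePairing_le (𝕜 := 𝕜) (v n) (τ n)
    rw [← heq n hn, map_add, map_add, map_smul, map_sum, heq n hn] at h
    simpa [hq, hG] using h
  -- Bounds the energy deficit of the Euler step; it accounts for the extra 1/4 in the factor 5/4
  -- below.
  have hfirst : ‖v 1‖ ^ 2 ≤ k * (‖v 1‖ * ‖τ 1‖) := by
    have h := htest 1 le_rfl
    have hq1 : 0 ≤ k ^ α * q 1 := by
      have : q 1 = cqWeight α 0 * G 1 1 := by simp [hq]
      rw [this]
      exact mul_nonneg hkα.le (mul_nonneg (cqWeight_pos hα₀ 0).le (hGn 1))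
    have hd : rePairing 𝕜 (v 1) (schemeDiff k v 1) = k⁻¹ * ‖v 1‖ ^ 2 := by
      rw [map_schemeDiff, schemeDiff, if_pos rfl, bdiff, smul_eq_mul, rePairing_self, Nat.sub_self,
        show v 0 = 0 from he, map_zero, sub_zero]
    have h' : k⁻¹ * ‖v 1‖ ^ 2 ≤ ‖v 1‖ * ‖τ 1‖ := by linarith [hGn 1]
    rwa [inv_mul_le_iff₀ hk] at h'
  have hstep : ∀ i : ℕ, (bdfEnergy v (i + 1) - bdfEnergy v i) / 4 + k * (k ^ α * q (i + 1)) ≤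
      5 / 4 * k * (‖v (i + 1)‖ * ‖τ (i + 1)‖) := by
    intro i
    have h₁ := bdfEnergy_sub_le (𝕜 := 𝕜) (e := v) he hk i
    have h₂ := mul_le_mul_of_nonneg_left (htest (i + 1) (by omega)) hk.le
    have h₃ : (if i = 0 then ‖v 1‖ ^ 2 / 4 else 0) ≤ k * (‖v (i + 1)‖ * ‖τ (i + 1)‖) / 4 := by
      split_ifs with hi
      · rw [hi]; linarith
      · positivity
    have h₄ := mul_nonneg hk.le (hGn (i + 1))
    linarith
  -- The positivity result includes the index 0, whereas the scheme sums from p = 1. As e 0 = 0, the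
  -- row and the column of index 0 vanish.
  have hquad : 0 ≤ ∑ i ∈ Finset.range N, r ^ (2 * (i + 1)) * q (i + 1) := by
    have h := cq_form_nonneg (G := G) (N := N + 1) hα₀ hα₁ hr₀.le hr₁ (fun n p => by
        simp only [hG, hv]
        rw [hA.rePairing_map, rePairing_comm]) (hA.gram_nonneg e (N + 1))
    have hv0 : ∀ p, G 0 p = 0 := fun p => by
      simp only [hG, hv]
      rw [he, rePairing_comm, map_zero]
    have hA0 : e 0 = 0 := by exact_mod_cast he
    have hA0' : ∀ n, G n 0 = 0 := fun n => by
      simp only [hG]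
      rw [hA0, LinearPMap.map_zero, map_zero]
    rw [Finset.sum_range_succ'] at h
    simp only [hv0, mul_zero, Finset.sum_const_zero, add_zero] at h
    refine h.trans_eq (Finset.sum_congr rfl fun i _ => ?_)
    congr 1
    symm
    refine Finset.sum_subset (fun p hp => ?_) fun p hp hp' => ?_
    · rw [Finset.mem_Icc] at hp; rw [Finset.mem_range]; omega
    · have : p = 0 := by rw [Finset.mem_range] at hp; rw [Finset.mem_Icc] at hp'; omega
      rw [this, hA0', mul_zero]
  set S := ∑ i ∈ Finset.range N, r ^ (2 * (i + 1)) * ‖v (i + 1)‖ ^ 2 with hS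
  set Θ := ∑ i ∈ Finset.range N, r ^ (i + 1) * ‖τ (i + 1)‖ with hΘ
  have hS0 : 0 ≤ S := Finset.sum_nonneg fun i _ => by positivity
  have hΘ0 : 0 ≤ Θ := Finset.sum_nonneg fun i _ => by positivity
  have hsum := Finset.sum_le_sum fun i (_ : i ∈ Finset.range N) =>
    mul_le_mul_of_nonneg_left (hstep i) (by positivity : 0 ≤ (r ^ 2) ^ (i + 1))
  have hleft : (1 - r ^ 2) / 4 * S ≤ ∑ i ∈ Finset.range N, (r ^ 2) ^ (i + 1) *
      ((bdfEnergy v (i + 1) - bdfEnergy v i) / 4 + k * (k ^ α * q (i + 1))) := by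
    have e₁ : ∑ i ∈ Finset.range N, (r ^ 2) ^ (i + 1) *
        ((bdfEnergy v (i + 1) - bdfEnergy v i) / 4 + k * (k ^ α * q (i + 1))) =
        (∑ i ∈ Finset.range N, (r ^ 2) ^ (i + 1) * (bdfEnergy v (i + 1) - bdfEnergy v i)) / 4
        + k * k ^ α * ∑ i ∈ Finset.range N, r ^ (2 * (i + 1)) * q (i + 1) := by
      rw [Finset.sum_div, Finset.mul_sum, ← Finset.sum_add_distrib]
      refine Finset.sum_congr rfl fun i _ => ?_
      rw [pow_mul]
      ring
    have hE0 : bdfEnergy v 0 = 0 := by simp [bdfEnergy, hv, he]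
    have hEN : 0 ≤ bdfEnergy v N := by unfold bdfEnergy; positivity
    have hle : S ≤ ∑ i ∈ Finset.range N, (r ^ 2) ^ (i + 1) * bdfEnergy v (i + 1) :=
      Finset.sum_le_sum fun i _ => by
        rw [pow_mul, bdfEnergy]
        gcongr
        exact le_add_of_nonneg_right (by positivity)
    rw [e₁, sum_weighted_sub_eq, hE0]
    have h₁ := mul_le_mul_of_nonneg_left hle hρ.le
    have h₂ : 0 ≤ k * k ^ α * ∑ i ∈ Finset.range N, r ^ (2 * (i + 1)) * q (i + 1) := by positivity
    have h₃ : 0 ≤ (r ^ 2) ^ (N + 1) * bdfEnergy v N := by positivity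
    linarith
  have hright : ∑ i ∈ Finset.range N, (r ^ 2) ^ (i + 1) *
      (5 / 4 * k * (‖v (i + 1)‖ * ‖τ (i + 1)‖)) ≤ 5 / 4 * k * (√S * Θ) := by
    rw [hΘ, Finset.mul_sum, Finset.mul_sum]
    refine Finset.sum_le_sum fun i hi => ?_
    -- One factor is bounded by a single term of S, leaving the ℓ¹ sum Θ of the sources with the
    -- weight r^n instead of r^(2n).
    have hsq : r ^ (i + 1) * ‖v (i + 1)‖ ≤ √S := by
      refine Real.le_sqrt_of_sq_le ?_
      have := Finset.single_le_sum (f := fun i => r ^ (2 * (i + 1)) * ‖v (i + 1)‖ ^ 2)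
        (fun i _ => by positivity) hi
      refine le_trans (le_of_eq ?_) this
      rw [mul_comm 2, pow_mul]
      ring
    calc (r ^ 2) ^ (i + 1) * (5 / 4 * k * (‖v (i + 1)‖ * ‖τ (i + 1)‖))
        = 5 / 4 * k * ((r ^ (i + 1) * ‖v (i + 1)‖) * (r ^ (i + 1) * ‖τ (i + 1)‖)) := by
          rw [← pow_mul, mul_comm 2, pow_mul]; ring
      _ ≤ _ := by gcongr
  have hmain : (1 - r ^ 2) * (√S * √S) ≤ 5 * k * Θ * √S := by
    rw [Real.mul_self_sqrt hS0]
    linarith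
  have hroot : √S ≤ 5 / (1 - r ^ 2) * k * Θ := by
    rw [div_mul_eq_mul_div, div_mul_eq_mul_div, le_div_iff₀ hρ]
    rcases (Real.sqrt_nonneg S).eq_or_lt with h | h
    · rw [← h]; simp only [zero_mul]; positivity
    · nlinarith
  calc S = √S ^ 2 := (Real.sq_sqrt hS0).symm
    _ ≤ _ := by gcongr

end Stability

/-! ### Error equation. -/

section Error
variable {𝕜 H : Type*} [RCLike 𝕜] [NormedAddCommGroup H] [InnerProductSpace 𝕜 H]
  [NormedSpace ℝ H] {A : H →ₗ.[𝕜] H} {α k : ℝ} {f : ℝ → H} {u₀ : H}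
  {u u₁ u₂ : ℝ → A.domain} {u₃ : ℝ → H} {U : ℕ → A.domain}

lemma schemeDiff_sub {E : Type*} [NormedAddCommGroup E] [NormedSpace ℝ E] (k : ℝ) (v w : ℕ → E)
    (n : ℕ) : schemeDiff k (fun p => v p - w p) n = schemeDiff k v n - schemeDiff k w n := by
  unfold schemeDiff
  split_ifs
  · simp only [bdiff]; module
  · simp only [bdiff2, bdiff]; module

/-- The error of the scheme solves the scheme with the truncation error as right-hand side. -/
lemma error_equation (hk : 0 < k) (hsol : IsSolution A (abelKernel α) f u₀ u)
    (hu : HasTimeDerivs A u u₁ u₂ u₃) (hU : IsBDF2Solution A α k f u₀ U) (n : ℕ) (hn : 1 ≤ n) :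
    schemeDiff k (fun p => ((U p - u (p * k) : A.domain) : H)) n + A (U n - u (n * k))
      + k ^ α • ∑ p ∈ Finset.Icc 1 n, cqWeight α (n - p) • A (U p - u (p * k)) =
      truncError A α k u u₁ n := by
  have hnk : 0 < (n : ℝ) * k := by
    have : (1 : ℝ) ≤ n := by exact_mod_cast hn
    positivity
  have hscheme : schemeDiff k (fun p => (U p : H)) n + A (U n)
      + cqRule α k (fun p => A (U p)) n = f (n * k) := by
    rcases eq_or_ne n 1 with rfl | h1
    · simpa [schemeDiff] using hU.first
    · rw [schemeDiff, if_neg h1]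
      exact hU.step n (by omega)
  have hderiv : deriv (fun s => (u s : H)) (n * k) = u₁ (n * k) :=
    ((hu.first _ hnk.le).hasDerivAt (Ici_mem_nhds hnk)).deriv
  have heq := hsol.equation (n * k) hnk
  rw [hderiv, ← hscheme] at heq
  -- The starting values agree, so the starting weights cancel from the error equation.
  have hzero : U 0 = u ((0 : ℕ) * k) := by
    rw [Nat.cast_zero, zero_mul]
    exact Subtype.ext (hU.initial.trans hsol.initial.symm)
  have hcq : cqRule α k (fun p => A (U p)) n - cqRule α k (fun p : ℕ => A (u (p * k))) n =
      k ^ α • ∑ p ∈ Finset.Icc 1 n, cqWeight α (n - p) • A (U p - u (p * k)) := by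
    simp only [cqRule, LinearPMap.map_sub, smul_sub, Finset.sum_sub_distrib, hzero]
    abel
  have hdiff : schemeDiff k (fun p => ((U p - u (p * k) : A.domain) : H)) n =
      schemeDiff k (fun p => (U p : H)) n - schemeDiff k (fun p : ℕ => (u (p * k) : H)) n :=
    schemeDiff_sub k (fun p => (U p : H)) (fun p : ℕ => (u (p * k) : H)) n
  rw [hdiff, ← hcq, truncError, LinearPMap.map_sub]
  have := congrArg (fun x => x - schemeDiff k (fun p : ℕ => (u (p * k) : H)) n - A (u (n * k))
    - cqRule α k (fun p : ℕ => A (u (p * k))) n) heq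
  rw [← sub_eq_zero] at this ⊢
  rw [← neg_eq_zero, ← this]
  abel

end Error

/-! ### Summation of the truncation errors and conclusion. -/

section Weighted

lemma tsum_shifted_pair_le (B : ℕ → ℝ≥0∞) : ∑' m, (B m + B (m + 1)) ≤ 2 * ∑' m, B m := by
  rw [ENNReal.tsum_add, two_mul]
  exact add_le_add le_rfl (ENNReal.tsum_comp_le_tsum_of_injective (add_left_injective 1) B)

lemma weightedNorm_le_of_sum_le {E : Type*} [NormedAddCommGroup E] {c : ℝ} {v : ℕ → E}
    {M : ℝ≥0∞} (h : ∀ N, ∑ n ∈ Finset.range N, ENNReal.ofReal (Real.exp (-c * n)) * ‖v n‖ₑ ^ 2 ≤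
      M ^ 2) : weightedNorm c v ≤ M := by
  have h1 := ENNReal.tsum_le_of_sum_range_le h
  calc weightedNorm c v ≤ (M ^ 2) ^ (1 / 2 : ℝ) := ENNReal.rpow_le_rpow h1 (by norm_num)
    _ = M := by
      rw [← ENNReal.rpow_natCast, ← ENNReal.rpow_mul]
      norm_num

end Weighted

end BDF2Abel

end

open BDF2Abel in
theorem theorem3p19 (α c : ℝ) (hα₀ : 0 < α) (hα₁ : α < 1) (hc : 0 < c) :
    ∃ C : ℝ, 0 < C ∧
      ∀ (𝕜 H : Type*) [RCLike 𝕜] [NormedAddCommGroup H] [InnerProductSpace 𝕜 H]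
        [NormedSpace ℝ H] [IsScalarTower ℝ 𝕜 H] [CompleteSpace H]
        (A : H →ₗ.[𝕜] H) (k : ℝ) (f : ℝ → H) (u₀ : H)
        (u u₁ u₂ : ℝ → A.domain) (u₃ : ℝ → H) (U : ℕ → A.domain),
        BDF2Abel.IsSelfAdjointPosDef A →
        0 < k →
        BDF2Abel.IsSolution A (BDF2Abel.abelKernel α) f u₀ u →
        BDF2Abel.HasTimeDerivs A u u₁ u₂ u₃ →
        BDF2Abel.IsBDF2Solution A α k f u₀ U →
        BDF2Abel.weightedNorm c (fun n => (U n : H) - (u (n * k) : H)) ≤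
          ENNReal.ofReal (C * k) *
            ((∑' m : ℕ, let n : ℕ := m + 1
                ENNReal.ofReal (Real.exp (-(c / 2) * n)) *
                  (∫⁻ ζ in Set.Ioo 0 (2 * k), ‖(u₂ ζ : H)‖ₑ))
              + ENNReal.ofReal k * (∑' m : ℕ, let n : ℕ := m + 2
                ENNReal.ofReal (Real.exp (-(c / 2) * n)) *
                  (∫⁻ ζ in Set.Ioo (((n : ℝ) - 1) * k) (n * k), ‖u₃ ζ‖ₑ))
              + (∑' m : ℕ, let n : ℕ := m + 1
                ENNReal.ofReal (Real.exp (-(c / 2) * n)) *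
                  (ENNReal.ofReal (k ^ 2 * (n * k) ^ (α - 1)) * ‖A (u₁ 0)‖ₑ
                    + ENNReal.ofReal (k ^ (α + 1)) *
                        (∫⁻ ζ in Set.Ioo (((n : ℝ) - 1) * k) (n * k), ‖A (u₂ ζ)‖ₑ)
                    + ENNReal.ofReal (k ^ 2) *
                        (∫⁻ ζ in Set.Ioo 0 (((n : ℝ) - 1) * k),
                          ENNReal.ofReal ((n * k - ζ) ^ (α - 1)) * ‖A (u₂ ζ)‖ₑ)))) := by
  obtain ⟨C, hC, hquad⟩ := exists_enorm_rePairing_quadrature_le hα₀ hα₁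
  -- With this r, r^(2n) is the weight of the norm and r^n the weight e^(-cn/2) of the bound.
  set r : ℝ := Real.exp (-(c / 2)) with hr
  have hr₀ : 0 < r := Real.exp_pos _
  have hr₁ : r < 1 := by rw [hr, Real.exp_lt_one_iff]; linarith
  have hpow (n : ℕ) : Real.exp (-(c / 2) * n) = r ^ n := by rw [hr, ← Real.exp_nat_mul, mul_comm]
  have hpow2 (n : ℕ) : Real.exp (-c * n) = r ^ (2 * n) := by
    rw [hr, ← Real.exp_nat_mul]; congr 1; push_cast; ring
  have hρ : 0 < 1 - r ^ 2 := by nlinarith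
  set K : ℝ := 5 / (1 - r ^ 2) with hK
  have hK0 : 0 < K := by positivity
  -- K comes from stability and C from the quadrature. The 4 covers the constant 3 of the first two
  -- levels and 2 · 2 for the later ones, where each integral of u₃ is used by two levels.
  refine ⟨K * (4 + C), by positivity, ?_⟩
  intro 𝕜 H _ _ _ _ _ _ A k f u₀ u u₁ u₂ u₃ U hA hk hsol hu hU
  simp only [hpow]
  set I := ∫⁻ ζ in Set.Ioo 0 (2 * k), ‖(u₂ ζ : H)‖ₑ with hI
  set J : ℕ → ℝ≥0∞ := fun n => ∫⁻ ζ in Set.Ioo (((n : ℝ) - 1) * k) (n * k), ‖u₃ ζ‖ₑ with hJ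
  set D : ℕ → ℝ≥0∞ := fun n => ENNReal.ofReal (k ^ 2 * (n * k) ^ (α - 1)) * ‖A (u₁ 0)‖ₑ
    + ENNReal.ofReal (k ^ (α + 1)) *
      (∫⁻ ζ in Set.Ioo (((n : ℝ) - 1) * k) (n * k), ‖A (u₂ ζ)‖ₑ)
    + ENNReal.ofReal (k ^ 2) * (∫⁻ ζ in Set.Ioo 0 (((n : ℝ) - 1) * k),
      ENNReal.ofReal ((n * k - ζ) ^ (α - 1)) * ‖A (u₂ ζ)‖ₑ) with hD
  set ω : ℕ → ℝ≥0∞ := fun n => ENNReal.ofReal (r ^ n) with hω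
  have hω_anti : ∀ n, ω (n + 1) ≤ ω n := fun n =>
    ENNReal.ofReal_le_ofReal (pow_le_pow_of_le_one hr₀.le hr₁.le (Nat.le_succ n))
  change weightedNorm c (fun n => (U n : H) - (u (n * k) : H)) ≤
    ENNReal.ofReal (K * (4 + C) * k) * ((∑' m : ℕ, ω (m + 1) * I)
      + ENNReal.ofReal k * (∑' m : ℕ, ω (m + 2) * J (m + 2)) + ∑' m : ℕ, ω (m + 1) * D (m + 1))
  set τ : ℕ → H := truncError A α k u u₁ with hτ
  have hdense := hA.selfAdjoint.dense_domain
  have hτ_low : ∀ n, n = 1 ∨ n = 2 → ‖τ n‖ₑ ≤ ENNReal.ofReal 3 * I + ENNReal.ofReal C * D n := by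
    intro n hn
    refine enorm_le_of_rePairing_le (𝕜 := 𝕜) hdense _ _ fun y hy => ?_
    rw [hτ, truncError, map_add, add_mul]
    exact (enorm_add_le _ _).trans (add_le_add (enorm_rePairing_diff_le hu hk y hn)
      (hquad 𝕜 H A k f u₀ u u₁ u₂ u₃ ⟨y, hy⟩ n hA hk (by omega) hsol hu))
  have hτ_high : ∀ n, 3 ≤ n → ‖τ n‖ₑ ≤ ENNReal.ofReal (2 * k) * (J (n - 1) + J n)
      + ENNReal.ofReal C * D n := by
    intro n hn
    refine enorm_le_of_rePairing_le (𝕜 := 𝕜) hdense _ _ fun y hy => ?_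
    rw [hτ, truncError, map_add, add_mul]
    refine (enorm_add_le _ _).trans (add_le_add ?_
      (hquad 𝕜 H A k f u₀ u u₁ u₂ u₃ ⟨y, hy⟩ n hA hk (by omega) hsol hu))
    have h := enorm_rePairing_diff_le_of_three_le hu hk y hn
    have e₁ : ((n - 1 : ℕ) : ℝ) = (n : ℝ) - 1 := by rw [Nat.cast_sub (by omega)]; simp
    have e₂ : (n : ℝ) - 1 - 1 = n - 2 := by ring
    simp only [hJ, e₁, e₂]
    exact h
  -- summation of the truncation errors
  set S₁ := ∑' m : ℕ, ω (m + 1) * I with hS₁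
  set S₂ := ∑' m : ℕ, ω (m + 2) * J (m + 2) with hS₂
  set S₃ := ∑' m : ℕ, ω (m + 1) * D (m + 1) with hS₃
  have hΘ : ∑' m : ℕ, ω (m + 1) * ‖τ (m + 1)‖ₑ ≤
      ENNReal.ofReal (4 + C) * (S₁ + ENNReal.ofReal k * S₂ + S₃) := by
    set B : ℕ → ℝ≥0∞ := fun m => ω (m + 2) * J (m + 2) with hB
    -- The index m stands for level m + 1. Levels 1 and 2 need no u₃; a later level uses the
    -- integrals over the last two steps, and the older one may take its own larger weight since ω
    -- decreases.
    set B' : ℕ → ℝ≥0∞ := fun m => if m < 2 then 0 else B (m - 2) + B (m - 1) with hB'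
    have hterm : ∀ m, ω (m + 1) * ‖τ (m + 1)‖ₑ ≤ ENNReal.ofReal 3 * (ω (m + 1) * I)
        + ENNReal.ofReal (2 * k) * B' m + ENNReal.ofReal C * (ω (m + 1) * D (m + 1)) := by
      intro m
      by_cases hm : m < 2
      · simp only [hB', if_pos hm, mul_zero, add_zero]
        calc ω (m + 1) * ‖τ (m + 1)‖ₑ
            ≤ ω (m + 1) * (ENNReal.ofReal 3 * I + ENNReal.ofReal C * D (m + 1)) := by
              gcongr; exact hτ_low (m + 1) (by omega)
          _ = _ := by ring
      · obtain ⟨j, rfl⟩ : ∃ j, m = j + 2 := ⟨m - 2, by omega⟩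
        simp only [hB', if_neg hm, Nat.add_sub_cancel, show j + 2 - 1 = j + 1 by omega, hB]
        calc ω (j + 2 + 1) * ‖τ (j + 2 + 1)‖ₑ
            ≤ ω (j + 2 + 1) * (ENNReal.ofReal (2 * k) * (J (j + 2) + J (j + 2 + 1))
                + ENNReal.ofReal C * D (j + 2 + 1)) := by
              gcongr; exact hτ_high (j + 2 + 1) (by omega)
          _ = ENNReal.ofReal (2 * k) * (ω (j + 2 + 1) * J (j + 2) + ω (j + 2 + 1) * J (j + 2 + 1))
                + ENNReal.ofReal C * (ω (j + 2 + 1) * D (j + 2 + 1)) := by ring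
          _ ≤ ENNReal.ofReal (2 * k) * (ω (j + 2) * J (j + 2) + ω (j + 1 + 2) * J (j + 1 + 2))
                + ENNReal.ofReal C * (ω (j + 2 + 1) * D (j + 2 + 1)) := by
              gcongr ENNReal.ofReal (2 * k) * (?_ * J (j + 2) + ?_) + _
              · exact hω_anti (j + 2)
              · exact le_rfl
          _ ≤ _ := by
              gcongr
              exact le_add_self
    have hB'sum : ∑' m, B' m ≤ 2 * S₂ := by
      rw [tsum_eq_zero_add' ENNReal.summable, tsum_eq_zero_add' ENNReal.summable]
      simp only [hB', show ∀ m, ¬ (m + 1 + 1 < 2) by omega]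
      simpa using tsum_shifted_pair_le B
    calc ∑' m : ℕ, ω (m + 1) * ‖τ (m + 1)‖ₑ
        ≤ ∑' m : ℕ, (ENNReal.ofReal 3 * (ω (m + 1) * I) + ENNReal.ofReal (2 * k) * B' m
            + ENNReal.ofReal C * (ω (m + 1) * D (m + 1))) := ENNReal.tsum_le_tsum hterm
      _ = ENNReal.ofReal 3 * S₁ + ENNReal.ofReal (2 * k) * (∑' m, B' m)
            + ENNReal.ofReal C * S₃ := by
          rw [ENNReal.tsum_add, ENNReal.tsum_add, ENNReal.tsum_mul_left, ENNReal.tsum_mul_left,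
            ENNReal.tsum_mul_left]
      _ ≤ ENNReal.ofReal 3 * S₁ + ENNReal.ofReal (2 * k) * (2 * S₂) + ENNReal.ofReal C * S₃ := by
          gcongr
      _ = ENNReal.ofReal 3 * S₁ + ENNReal.ofReal 4 * (ENNReal.ofReal k * S₂)
            + ENNReal.ofReal C * S₃ := by
          have h4 : ENNReal.ofReal 4 = ENNReal.ofReal 2 * 2 := by
            rw [ENNReal.ofReal_ofNat, ENNReal.ofReal_ofNat]; norm_num
          rw [ENNReal.ofReal_mul zero_le_two, h4]
          ring
      _ ≤ ENNReal.ofReal (4 + C) * S₁ + ENNReal.ofReal (4 + C) * (ENNReal.ofReal k * S₂)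
            + ENNReal.ofReal (4 + C) * S₃ := by
          gcongr <;> linarith
      _ = _ := by ring
  -- stability
  refine weightedNorm_le_of_sum_le fun N => ?_
  set e : ℕ → A.domain := fun p => U p - u (p * k) with he
  have he0 : (e 0 : H) = 0 := by
    simp only [he, Nat.cast_zero, zero_mul]
    rw [Submodule.coe_sub, hU.initial, hsol.initial, sub_self]
  have hstab := scheme_stability hA hα₀ hα₁ hk hr₀ hr₁ e he0 τ
    (fun n hn => error_equation hk hsol hu hU n hn) N
  have hle : ∑ n ∈ Finset.range N,
      ENNReal.ofReal (Real.exp (-c * n)) * ‖(U n : H) - (u (n * k) : H)‖ₑ ^ 2 ≤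
      ENNReal.ofReal (∑ i ∈ Finset.range N, r ^ (2 * (i + 1)) * ‖(e (i + 1) : H)‖ ^ 2) := by
    have e₁ : ∀ n : ℕ, ENNReal.ofReal (Real.exp (-c * n)) *
        ‖(U n : H) - (u (n * k) : H)‖ₑ ^ 2 = ENNReal.ofReal (r ^ (2 * n) * ‖(e n : H)‖ ^ 2) := by
      intro n
      rw [hpow2, ENNReal.ofReal_mul (by positivity), ENNReal.ofReal_pow (norm_nonneg _),
        ofReal_norm]
      rfl
    simp_rw [e₁]
    rw [ENNReal.ofReal_sum_of_nonneg fun i _ => by positivity]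
    refine (Finset.sum_le_sum_of_subset (Finset.range_mono (Nat.le_succ N))).trans_eq ?_
    rw [Finset.sum_range_succ', he0]
    simp
  refine hle.trans ((ENNReal.ofReal_le_ofReal hstab).trans ?_)
  rw [ENNReal.ofReal_pow (mul_nonneg (by positivity)
    (Finset.sum_nonneg fun i _ => by positivity)), ENNReal.ofReal_mul (by positivity)]
  gcongr ?_ ^ 2
  have hpart : ENNReal.ofReal (∑ i ∈ Finset.range N, r ^ (i + 1) * ‖τ (i + 1)‖) ≤
      ∑' m : ℕ, ω (m + 1) * ‖τ (m + 1)‖ₑ := by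
    rw [ENNReal.ofReal_sum_of_nonneg fun i _ => by positivity]
    refine le_trans (le_of_eq (Finset.sum_congr rfl fun i _ => ?_)) (ENNReal.sum_le_tsum _)
    rw [ENNReal.ofReal_mul (by positivity), ofReal_norm]
  calc ENNReal.ofReal (5 / (1 - r ^ 2) * k) *
        ENNReal.ofReal (∑ i ∈ Finset.range N, r ^ (i + 1) * ‖τ (i + 1)‖)
      ≤ ENNReal.ofReal (K * k) *
        (ENNReal.ofReal (4 + C) * (S₁ + ENNReal.ofReal k * S₂ + S₃)) := by
        gcongr
        exact hpart.trans hΘ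
    _ = _ := by
        rw [← mul_assoc, ← ENNReal.ofReal_mul (by positivity)]
        congr 2
        ring
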